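/- **Setting.** Let $v\in\ell^1(\mathbb Z^2,\mathbb R)$ satisfy $v(-x)=v(x)$ and $v(-x_2,x_1)=v(x_1,x_2)$ for all $x=(x_1,x_2)\in\mathbb Z^2$, with Fourier transform $\hat v(k)=\sum_{x}e^{-ik\cdot x}v(x)$, and let $\kappa>0$, $h_b\ge 0$. For a hopping amplitude $h>0$ and a repulsion $U>0$ consider, on the tensor product of the fermionic Fock space over $\ell^2(\mathbb Z^2;\mathbb C^2)$ (spin $\mathrm s\in\{\uparrow,\downarrow\}$, annihilation operators $a_{x,\mathrm s}$, $n_{x,\mathrm s}=a^*_{x,\mathrm s}a_{x,\mathrm s}$) and the bosonic Fock space over $\ell^2(\mathbb Z^2;\mathbb C)$ (annihilation operators $b_x$), the Hamiltonian $$\mathbf H=h\Big(-\tfrac12\sum_{\mathrm s,\,|x-y|=1}a^*_{x,\mathrm s}a_{y,\mathrm s}+2\sum_{\mathrm s,x}a^*_{x,\mathrm s}a_{x,\mathrm s}\Big)+U\sum_x n_{x,\uparrow}n_{x,\downarrow}+h\Big(-\tfrac{h_b}2\sum_{|x-y|=1}b^*_xb_y+2h_b\sum_xb^*_xb_x\Big)+\sum_{x,y}v(x-y)\big(b^*_xc_y+c^*_yb_x\big),$$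 where $c_x=\sum_{|z|\le1}e^{-\kappa|z|}a_{x+z,\uparrow}a_{x,\downarrow}$. It leaves invariant the sector of one pair of fermions of opposite spins or one boson, which is identified with $\ell^2(\mathbb Z^2\times\mathbb Z^2;\mathbb C)\times\ell^2(\mathbb Z^2;\mathbb C)\ni(\mathfrak c,\mathfrak b)$ so that $a_{x,\uparrow}a_{y,\downarrow}\mathfrak c=\mathfrak c(x,y)$. Let $H^{(2,1)}$ be the bounded self-adjoint restriction of $\mathbf H$ to this sector and $E_0=\inf\sigma(H^{(2,1)})$. For $\varepsilon>0$ let $\Xi_\varepsilon$ be the set of all $C^1$ solutions $t\mapsto(\mathfrak c_t,\mathfrak b_t)$, $t\in\mathbb R$, of $i\frac{d}{dt}(\mathfrak c_t,\mathfrak b_t)=H^{(2,1)}(\mathfrak c_t,\mathfrak b_t)$ that have norm one and take values in the range of the spectral projection $\mathbf 1_{[E_0,E_0(1-\varepsilon)]}(H^{(2,1)})$. For $k\in[-\pi,\pi)^2$ let $$\mathbf s_k(y)=\tfrac12\sum_{z\in\mathbb Z^2,\,|z|=1}e^{ik\cdot z}\delta_{y,z}\quad(y\in\mathbb Z^2),\qquad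 \mathbf d:=\mathbf s_{(-\pi,0)},$$ and let $\mathfrak K_v$ be the set of maximizers of $|\hat v|$ in $[-\pi,\pi)^2$. **Corollary.** Assume $\mathfrak K_v=\{(-\pi,0),(0,-\pi)\}$. Then for every $\eta>0$ there are $\varepsilon_0,h_0,U_0>0$ such that for all $\varepsilon\in(0,\varepsilon_0)$, $h\in(0,h_0)$, $U>U_0$ and all $(\mathfrak c_t,\mathfrak b_t)\in\Xi_\varepsilon$ there is $f\in C(\mathbb R,\ell^2(\mathbb Z^2;\mathbb C))$ with $$\sum_{x_\uparrow,x_\downarrow\in\mathbb Z^2}\big|\mathfrak c_t(x_\uparrow,x_\downarrow)-\mathbf d(x_\uparrow-x_\downarrow)f_t(x_\uparrow)\big|^2\le\eta\qquad\text{for all }t\in\mathbb R .$$ Moreover $\mathbf d=\mathbf s_{(-\pi,0)}=-\mathbf s_{(0,-\pi)}$, and its Fourier transform is $\hat{\mathbf d}(k_1,k_2)=\cos k_2-\cos k_1$. -/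

import Mathlib

namespace DWave

/-! ### Lattice, Fock space, creation and annihilation operators -/

/-- The lattice `ℤ²`. -/
abbrev Site := ℤ × ℤ

/-- A fermionic one-particle mode: a site and a spin; `true` is spin up, `false` is spin down. -/
abbrev Mode := Site × Bool

/-- The four lattice vectors of Euclidean length one. -/
def nn : Finset Site := {(1, 0), (-1, 0), (0, 1), (0, -1)}

/-- Wave functions of the fermion-boson Fock space: `ψ m n X Y` is the amplitude of `m` fermions in
the modes `X` and `n` spinless bosons at the sites `Y`. The Fock space `𝓕₋ ⊗ 𝓕₊` consists of the
square-summable families that are antisymmetric in `X` and symmetric in `Y`. -/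
abbrev FockFun := (m n : ℕ) → (Fin m → Mode) → (Fin n → Site) → ℂ

/-- Fermion annihilation operator `a_z`. -/
noncomputable def annF (z : Mode) (ψ : FockFun) : FockFun := fun m n X Y =>
  (Real.sqrt (m + 1) : ℂ) * ψ (m + 1) n (Fin.cons z X) Y

/-- Fermion creation operator `a_z^*`. -/
noncomputable def creF (z : Mode) (ψ : FockFun) : FockFun
  | 0, _, _, _ => 0
  | m + 1, n, X, Y => (Real.sqrt (m + 1) : ℂ)⁻¹ *
      ∑ j : Fin (m + 1), if X j = z then (-1) ^ (j : ℕ) * ψ m n (j.removeNth X) Y else 0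

/-- Boson annihilation operator `b_x`. -/
noncomputable def annB (x : Site) (ψ : FockFun) : FockFun := fun m n X Y =>
  (Real.sqrt (n + 1) : ℂ) * ψ m (n + 1) X (Fin.cons x Y)

/-- Boson creation operator `b_x^*`. -/
noncomputable def creB (x : Site) (ψ : FockFun) : FockFun
  | _, 0, _, _ => 0
  | m, n + 1, X, Y => (Real.sqrt (n + 1) : ℂ)⁻¹ *
      ∑ j : Fin (n + 1), if Y j = x then ψ m n X (j.removeNth Y) else 0

/-- Fermion number operator `n_z = a_z^* a_z`. -/
noncomputable def numF (z : Mode) (ψ : FockFun) : FockFun := creF z (annF z ψ)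

/-- The pair annihilation operator `c_x = ∑_{|z| ≤ 1} e^{-κ|z|} a_{x+z,↑} a_{x,↓}`. -/
noncomputable def pairAnn (κ : ℝ) (x : Site) (ψ : FockFun) : FockFun :=
  annF (x, true) (annF (x, false) ψ) +
    ∑ z ∈ nn, (Real.exp (-κ) : ℂ) • annF (x + z, true) (annF (x, false) ψ)

/-- The pair creation operator `c_x^*`. -/
noncomputable def pairCre (κ : ℝ) (x : Site) (ψ : FockFun) : FockFun :=
  creF (x, false) (creF (x, true) ψ) +
    ∑ z ∈ nn, (Real.exp (-κ) : ℂ) • creF (x, false) (creF (x + z, true) ψ)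

/-- The fermionic (Hubbard) part, with hopping amplitude `h` and repulsion `U`:
`h (-½ ∑_{s,|x-y|=1} a_{x,s}^* a_{y,s} + 2 ∑_{s,x} a_{x,s}^* a_{x,s}) + U ∑_x n_{x,↑} n_{x,↓}`. -/
noncomputable def hamF (h U : ℝ) (ψ : FockFun) : FockFun := fun m n X Y =>
  (h : ℂ) * (-(1 / 2) * (∑ s : Bool, ∑' x : Site, ∑ z ∈ nn,
        creF (x, s) (annF (x + z, s) ψ) m n X Y)
      + 2 * ∑ s : Bool, ∑' x : Site, creF (x, s) (annF (x, s) ψ) m n X Y)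
    + (U : ℂ) * ∑' x : Site, numF (x, true) (numF (x, false) ψ) m n X Y

/-- The bosonic part `h (-(h_b/2) ∑_{|x-y|=1} b_x^* b_y + 2 h_b ∑_x b_x^* b_x)`. -/
noncomputable def hamB (h hb : ℝ) (ψ : FockFun) : FockFun := fun m n X Y =>
  (h : ℂ) * (-((hb : ℂ) / 2) * (∑' x : Site, ∑ z ∈ nn, creB x (annB (x + z) ψ) m n X Y)
      + 2 * (hb : ℂ) * ∑' x : Site, creB x (annB x ψ) m n X Y)

/-- The exchange interaction `W = ∑_{x,y} v(x-y) (b_x^* c_y + c_y^* b_x)`. -/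
noncomputable def exchange (κ : ℝ) (v : Site → ℝ) (ψ : FockFun) : FockFun := fun m n X Y =>
  ∑' x : Site, ∑' y : Site, (v (x - y) : ℂ) *
    (creB x (pairAnn κ y ψ) m n X Y + pairCre κ y (annB x ψ) m n X Y)

/-- The full Hamiltonian `𝐇 = H_f + H_b + W`. -/
noncomputable def fockHamiltonian (h U hb κ : ℝ) (v : Site → ℝ) (ψ : FockFun) : FockFun :=
  hamF h U ψ + hamB h hb ψ + exchange κ v ψ

/-! ### The sector of one zero-spin fermion pair or one boson -/

/-- `ℓ²(α; ℂ)`. -/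
noncomputable abbrev EllTwo (α : Type) := lp (fun _ : α => ℂ) 2

/-- The Hilbert space `ℓ²(ℤ² × ℤ²; ℂ) × ℓ²(ℤ²; ℂ)` of pairs `(𝔠, 𝔟)`. -/
abbrev Sector := WithLp 2 (EllTwo (Site × Site) × EllTwo Site)

/-- The antisymmetric function of two modes determined by `𝔠(x↑, x↓)`. -/
noncomputable def pairAmp (c : Site × Site → ℂ) : Mode → Mode → ℂ
  | (y, false), (x, true) => c (x, y)
  | (x, true), (y, false) => -c (x, y)
  | _, _ => 0

/-- The Fock wave function with two-fermion amplitude `𝔠` and one-boson amplitude `𝔟`. -/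
noncomputable def sectorFun (c : Site × Site → ℂ) (b : Site → ℂ) : FockFun
  | 2, 0, X, _ => (Real.sqrt 2 : ℂ)⁻¹ * pairAmp c (X 0) (X 1)
  | 0, 1, _, Y => b (Y 0)
  | _, _, _, _ => 0

/-- The canonical isometric embedding of the sector into Fock space; it is normalized so that the
vacuum amplitude of `a_{x,↑} a_{y,↓} 𝔠` is `𝔠(x, y)` (see `ann_ann_embed`). -/
noncomputable def embed (ψ : Sector) : FockFun := sectorFun (fun p => ψ.fst p) (fun x => ψ.snd x)

theorem ann_ann_embed (ψ : Sector) (x y : Site) (X : Fin 0 → Mode) (Y : Fin 0 → Site) :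
    annF (x, true) (annF (y, false) (embed ψ)) 0 0 X Y = ψ.fst (x, y) := by
  have h2 : (Real.sqrt 2 : ℂ) ≠ 0 := by
    exact_mod_cast (Real.sqrt_pos.mpr two_pos).ne'
  have : (Real.sqrt ((1 : ℝ) + 1)) = Real.sqrt 2 := by norm_num
  simp [annF, embed, sectorFun, pairAmp, this, h2]

/-! ### Existence of the restriction -/

section Existence

variable {α β : Type}

theorem sum_pull_le (f : α → β) (hf : Function.Injective f) (c : EllTwo β) (s : Finset α) :
    ∑ a ∈ s, ‖c (f a)‖ ^ (2 : ENNReal).toReal ≤ ‖c‖ ^ (2 : ENNReal).toReal := by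
  have := lp.sum_rpow_le_norm_rpow (p := 2) (by norm_num) c (s.map ⟨f, hf⟩)
  simpa using this

/-- Composition with an injective map, as a linear map between `ℓ²` spaces. -/
noncomputable def pullLin (f : α → β) (hf : Function.Injective f) :
    EllTwo β →ₗ[ℂ] EllTwo α where
  toFun c := ⟨fun a => c (f a), memℓp_gen' (sum_pull_le f hf c)⟩
  map_add' _ _ := rfl
  map_smul' _ _ := rfl

/-- Composition with an injective map, as an operator between `ℓ²` spaces. -/
noncomputable def pull (f : α → β) (hf : Function.Injective f) : EllTwo β →L[ℂ] EllTwo α :=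
  LinearMap.mkContinuous (pullLin f hf) 1 fun c => by
    rw [one_mul]
    exact lp.norm_le_of_forall_sum_le (by norm_num) (norm_nonneg _) (sum_pull_le f hf c)

theorem pull_apply (f : α → β) (hf : Function.Injective f) (c : EllTwo β) (a : α) :
    pull f hf c a = c (f a) := rfl

theorem norm_pull_le (f : α → β) (hf : Function.Injective f) : ‖pull f hf‖ ≤ 1 :=
  LinearMap.mkContinuous_norm_le _ zero_le_one _

/-- Extension by zero along an injective map. -/
noncomputable def push (f : α → β) (hf : Function.Injective f) : EllTwo α →L[ℂ] EllTwo β :=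
  ContinuousLinearMap.adjoint (pull f hf)

theorem push_apply [DecidableEq β] (f : α → β) (hf : Function.Injective f) (b : EllTwo α)
    (y : β) (x : α) (h : ∀ a, f a = y → a = x) :
    push f hf b y = if f x = y then b x else 0 := by
  classical
  have h1 : push f hf b y = inner ℂ (lp.single 2 y (1 : ℂ)) (push f hf b) := by
    rw [lp.inner_single_left]; simp
  rw [h1, push, ContinuousLinearMap.adjoint_inner_right]
  split_ifs with hy
  · have : pull f hf (lp.single 2 y (1 : ℂ)) = lp.single 2 x (1 : ℂ) := by
      ext a
      rw [pull_apply]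
      by_cases hax : a = x
      · subst hax; subst hy; simp
      · rw [lp.single_apply_ne _ _ _ hax, lp.single_apply_ne]
        exact fun h' => hax (h a h')
    rw [this, lp.inner_single_left]; simp
  · have : pull f hf (lp.single 2 y (1 : ℂ)) = 0 := by
      ext a
      rw [pull_apply, lp.single_apply_ne]
      · rfl
      · intro h'
        have := h a h'
        subst this
        exact hy h'
    rw [this, inner_zero_left]

/-- `b ↦ ∑_z v(z) b(e_z ·)` as a bounded operator, for `v ∈ ℓ¹`. -/
noncomputable def conv (v : lp (fun _ : Site => ℝ) 1) (e : Site → Site ≃ Site) :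
    EllTwo Site →L[ℂ] EllTwo Site :=
  ∑' z, (v z : ℂ) • pull (e z) (e z).injective

theorem conv_apply (v : lp (fun _ : Site => ℝ) 1) (e : Site → Site ≃ Site) (b : EllTwo Site)
    (x : Site) : conv v e b x = ∑' z, (v z : ℂ) * b (e z x) := by
  have hv : Summable fun z => ‖v z‖ := by
    have := (lp.memℓp v).summable (by norm_num)
    simpa using this
  have hs : Summable fun z => (v z : ℂ) • pull (e z) (e z).injective := by
    refine Summable.of_norm_bounded hv fun z => ?_
    rw [norm_smul]
    calc _ ≤ ‖(v z : ℂ)‖ * 1 := by gcongr; exact norm_pull_le _ _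
      _ = _ := by simp
  have h1 := ((ContinuousLinearMap.apply ℂ (EllTwo Site) b).hasSum hs.hasSum)
  have h2 := ((lp.evalCLM ℂ (fun _ : Site => ℂ) 2 x).hasSum h1)
  exact h2.tsum_eq.symm

end Existence

section
variable (c : Site × Site → ℂ) (b : Site → ℂ)

theorem sqrt_two_ne : (Real.sqrt 2 : ℂ) ≠ 0 := by
  exact_mod_cast (Real.sqrt_pos.mpr two_pos).ne'

theorem sqrt_one_add_one : Real.sqrt ((1 : ℝ) + 1) = Real.sqrt 2 := by norm_num

theorem sectorFun_add (c' : Site × Site → ℂ) (b' : Site → ℂ) :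
    sectorFun c b + sectorFun c' b' = sectorFun (c + c') (b + b') := by
  funext m n X Y
  simp only [Pi.add_apply]
  match m, n, X, Y with
  | 0, 0, X, Y => simp [sectorFun]
  | 0, 1, X, Y => simp [sectorFun]
  | 0, _ + 2, X, Y => simp [sectorFun]
  | 1, _, X, Y => simp [sectorFun]
  | 2, 0, X, Y =>
    obtain ⟨⟨p, s⟩, h⟩ : ∃ q, X 0 = q := ⟨_, rfl⟩
    obtain ⟨⟨p', s'⟩, h'⟩ : ∃ q, X 1 = q := ⟨_, rfl⟩
    simp only [sectorFun, h, h']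
    cases s <;> cases s' <;> simp [pairAmp] <;> ring
  | 2, _ + 1, X, Y => simp [sectorFun]
  | _ + 3, _, X, Y => simp [sectorFun]

theorem sectorFun_smul (r : ℂ) : r • sectorFun c b = sectorFun (r • c) (r • b) := by
  funext m n X Y
  simp only [Pi.smul_apply]
  match m, n, X, Y with
  | 0, 0, X, Y => simp [sectorFun]
  | 0, 1, X, Y => simp [sectorFun]
  | 0, _ + 2, X, Y => simp [sectorFun]
  | 1, _, X, Y => simp [sectorFun]
  | 2, 0, X, Y =>
    obtain ⟨⟨p, s⟩, h⟩ : ∃ q, X 0 = q := ⟨_, rfl⟩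
    obtain ⟨⟨p', s'⟩, h'⟩ : ∃ q, X 1 = q := ⟨_, rfl⟩
    simp only [sectorFun, h, h']
    cases s <;> cases s' <;> simp [pairAmp] <;> ring
  | 2, _ + 1, X, Y => simp [sectorFun]
  | _ + 3, _, X, Y => simp [sectorFun]

theorem sectorFun_tsum {ι : Type} (c : ι → Site × Site → ℂ) (b : ι → Site → ℂ) (m n : ℕ)
    (X : Fin m → Mode) (Y : Fin n → Site) :
    ∑' i, sectorFun (c i) (b i) m n X Y =
      sectorFun (fun p => ∑' i, c i p) (fun x => ∑' i, b i x) m n X Y := by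
  match m, n, X, Y with
  | 0, 0, X, Y => simp [sectorFun]
  | 0, 1, X, Y => simp [sectorFun]
  | 0, _ + 2, X, Y => simp [sectorFun]
  | 1, _, X, Y => simp [sectorFun]
  | 2, 0, X, Y =>
    obtain ⟨⟨p, s⟩, h⟩ : ∃ q, X 0 = q := ⟨_, rfl⟩
    obtain ⟨⟨p', s'⟩, h'⟩ : ∃ q, X 1 = q := ⟨_, rfl⟩
    simp only [sectorFun, h, h', tsum_mul_left]
    cases s <;> cases s' <;> simp [pairAmp, tsum_neg]
  | 2, _ + 1, X, Y => simp [sectorFun]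
  | _ + 3, _, X, Y => simp [sectorFun]

theorem sectorFun_zero : sectorFun 0 0 = 0 := by
  simpa using (sectorFun_smul 0 0 0).symm

theorem sectorFun_sum {ι : Type} (s : Finset ι) (c : ι → Site × Site → ℂ) (b : ι → Site → ℂ) :
    ∑ i ∈ s, sectorFun (c i) (b i) = sectorFun (∑ i ∈ s, c i) (∑ i ∈ s, b i) := by
  classical
  induction s using Finset.induction_on with
  | empty => simp [sectorFun_zero]
  | insert i s hi ih => rw [Finset.sum_insert hi, Finset.sum_insert hi, Finset.sum_insert hi, ih,
      sectorFun_add]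

theorem annF_sectorFun (z : Mode) (X : Fin 1 → Mode) (Y : Fin 0 → Site) :
    annF z (sectorFun c b) 1 0 X Y = pairAmp c z (X 0) := by
  simp [annF, sectorFun, sqrt_one_add_one]

theorem annF_sectorFun_zero (z : Mode) (m n : ℕ) (h : m ≠ 1 ∨ n ≠ 0) (X : Fin m → Mode)
    (Y : Fin n → Site) : annF z (sectorFun c b) m n X Y = 0 := by
  match m, n, h with
  | 0, 0, _ => simp [annF, sectorFun]
  | 0, _ + 1, _ => simp [annF, sectorFun]
  | 1, 0, h => simp at h
  | 1, _ + 1, _ => simp [annF, sectorFun]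
  | _ + 2, _, _ => simp [annF, sectorFun]

theorem hop_sectorFun (w z : Mode) (X : Fin 2 → Mode) (Y : Fin 0 → Site) :
    creF w (annF z (sectorFun c b)) 2 0 X Y = (Real.sqrt 2 : ℂ)⁻¹ *
      ((if X 0 = w then pairAmp c z (X 1) else 0)
        - if X 1 = w then pairAmp c z (X 0) else 0) := by
  simp only [creF, annF_sectorFun, Fin.removeNth]
  simp [sqrt_one_add_one, sub_eq_add_neg]
  split_ifs <;> simp

theorem hop_sectorFun_zero (w z : Mode) (m n : ℕ) (h : m ≠ 2 ∨ n ≠ 0) (X : Fin m → Mode)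
    (Y : Fin n → Site) : creF w (annF z (sectorFun c b)) m n X Y = 0 := by
  match m, h with
  | 0, _ => rfl
  | m + 1, h =>
    simp only [creF]
    rw [Finset.sum_eq_zero, mul_zero]
    intro j _
    rw [annF_sectorFun_zero _ _ _ _ _ (by omega)]; simp

theorem hop_up (w z : Site) : creF (w, true) (annF (z, true) (sectorFun c b)) =
    sectorFun (fun p => if p.1 = w then c (z, p.2) else 0) 0 := by
  funext m n X Y
  by_cases hmn : m = 2 ∧ n = 0
  · obtain ⟨rfl, rfl⟩ := hmn
    rw [hop_sectorFun]
    obtain ⟨⟨p, s⟩, h⟩ : ∃ q, X 0 = q := ⟨_, rfl⟩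
    obtain ⟨⟨p', s'⟩, h'⟩ : ∃ q, X 1 = q := ⟨_, rfl⟩
    simp only [sectorFun, h, h']
    cases s <;> cases s' <;> simp [pairAmp] <;> split_ifs <;> simp
  · rw [hop_sectorFun_zero _ _ _ _ _ _ (by omega)]
    match m, n, X, Y, hmn with
    | 0, 0, X, Y, _ => simp [sectorFun]
    | 0, 1, X, Y, _ => simp [sectorFun]
    | 0, _ + 2, X, Y, _ => simp [sectorFun]
    | 1, _, X, Y, _ => simp [sectorFun]
    | 2, 0, X, Y, h => simp at h
    | 2, _ + 1, X, Y, _ => simp [sectorFun]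
    | _ + 3, _, X, Y, _ => simp [sectorFun]

theorem hop_down (w z : Site) : creF (w, false) (annF (z, false) (sectorFun c b)) =
    sectorFun (fun p => if p.2 = w then c (p.1, z) else 0) 0 := by
  funext m n X Y
  by_cases hmn : m = 2 ∧ n = 0
  · obtain ⟨rfl, rfl⟩ := hmn
    rw [hop_sectorFun]
    obtain ⟨⟨p, s⟩, h⟩ : ∃ q, X 0 = q := ⟨_, rfl⟩
    obtain ⟨⟨p', s'⟩, h'⟩ : ∃ q, X 1 = q := ⟨_, rfl⟩
    simp only [sectorFun, h, h']
    cases s <;> cases s' <;> simp [pairAmp]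
  · rw [hop_sectorFun_zero _ _ _ _ _ _ (by omega)]
    match m, n, X, Y, hmn with
    | 0, 0, X, Y, _ => simp [sectorFun]
    | 0, 1, X, Y, _ => simp [sectorFun]
    | 0, _ + 2, X, Y, _ => simp [sectorFun]
    | 1, _, X, Y, _ => simp [sectorFun]
    | 2, 0, X, Y, h => simp at h
    | 2, _ + 1, X, Y, _ => simp [sectorFun]
    | _ + 3, _, X, Y, _ => simp [sectorFun]

theorem boson_hop (x y : Site) : creB x (annB y (sectorFun c b)) =
    sectorFun 0 (fun p => if p = x then b y else 0) := by
  funext m n X Y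
  match m, n, X, Y with
  | 0, 0, X, Y => simp [sectorFun, creB]
  | 0, 1, X, Y => simp [sectorFun, creB, annB]
  | 0, _ + 2, X, Y => simp [sectorFun, creB, annB]
  | 1, 0, X, Y => simp [sectorFun, creB]
  | 1, _ + 1, X, Y => simp [sectorFun, creB, annB]
  | 2, 0, X, Y => simp [sectorFun, creB, pairAmp]; split <;> simp
  | 2, _ + 1, X, Y => simp [sectorFun, creB, annB]
  | _ + 3, 0, X, Y => simp [sectorFun, creB]
  | _ + 3, _ + 1, X, Y => simp [sectorFun, creB, annB]

/-- The vacuum amplitude `r`. -/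
noncomputable def vac (r : ℂ) : FockFun
  | 0, 0, _, _ => r
  | _, _, _, _ => 0

theorem ann_ann (x y : Site) : annF (x, true) (annF (y, false) (sectorFun c b)) =
    vac (c (x, y)) := by
  funext m n X Y
  match m, n, X, Y with
  | 0, 0, X, Y =>
    rw [annF, annF_sectorFun]; simp [pairAmp, vac]
  | 0, _ + 1, X, Y => rw [annF, annF_sectorFun_zero _ _ _ _ _ (by omega)]; simp [vac]
  | _ + 1, _, X, Y => rw [annF, annF_sectorFun_zero _ _ _ _ _ (by omega)]; simp [vac]

theorem creB_vac (x : Site) (r : ℂ) : creB x (vac r) =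
    sectorFun 0 (fun p => if p = x then r else 0) := by
  funext m n X Y
  match m, n, X, Y with
  | 0, 0, X, Y => simp [sectorFun, creB]
  | 0, 1, X, Y => simp [sectorFun, creB, vac]
  | 0, _ + 2, X, Y => simp [sectorFun, creB, vac]
  | 1, 0, X, Y => simp [sectorFun, creB]
  | 1, _ + 1, X, Y => simp [sectorFun, creB, vac]
  | 2, 0, X, Y => simp [sectorFun, creB, pairAmp]; split <;> simp
  | 2, _ + 1, X, Y => simp [sectorFun, creB, vac]
  | _ + 3, 0, X, Y => simp [sectorFun, creB]
  | _ + 3, _ + 1, X, Y => simp [sectorFun, creB, vac]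

theorem annB_sectorFun (x : Site) : annB x (sectorFun c b) = vac (b x) := by
  funext m n X Y
  match m, n, X, Y with
  | 0, 0, X, Y => simp [sectorFun, annB, vac]
  | 0, _ + 1, X, Y => simp [sectorFun, annB, vac]
  | 1, _, X, Y => simp [sectorFun, annB, vac]
  | 2, _, X, Y => simp [sectorFun, annB, vac]
  | _ + 3, _, X, Y => simp [sectorFun, annB, vac]

theorem cre_cre_vac (x y : Site) (r : ℂ) : creF (y, false) (creF (x, true) (vac r)) =
    sectorFun (fun p => if p = (x, y) then r else 0) 0 := by
  funext m n X Y
  match m, n, X, Y with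
  | 0, 0, X, Y => simp [sectorFun, creF]
  | 0, 1, X, Y => simp [sectorFun, creF]
  | 0, _ + 2, X, Y => simp [sectorFun, creF]
  | 1, _, X, Y => simp [sectorFun, creF]
  | 2, 0, X, Y =>
    obtain ⟨⟨p, s⟩, h⟩ : ∃ q, X 0 = q := ⟨_, rfl⟩
    obtain ⟨⟨p', s'⟩, h'⟩ : ∃ q, X 1 = q := ⟨_, rfl⟩
    simp only [sectorFun, h, h', creF, vac, Fin.removeNth]
    cases s <;> cases s' <;> simp [pairAmp, sqrt_one_add_one, h, h'] <;> grind
  | 2, _ + 1, X, Y => simp [sectorFun, creF, vac]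
  | _ + 3, _, X, Y => simp [sectorFun, creF, vac]

theorem vac_add (r s : ℂ) : vac r + vac s = vac (r + s) := by
  funext m n X Y
  match m, n, X, Y with
  | 0, 0, X, Y => simp [vac]
  | 0, _ + 1, X, Y => simp [vac]
  | _ + 1, _, X, Y => simp [vac]

theorem vac_smul (r s : ℂ) : r • vac s = vac (r * s) := by
  funext m n X Y
  match m, n, X, Y with
  | 0, 0, X, Y => simp [vac]
  | 0, _ + 1, X, Y => simp [vac]
  | _ + 1, _, X, Y => simp [vac]

theorem vac_sum {ι : Type} (s : Finset ι) (f : ι → ℂ) :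
    ∑ i ∈ s, vac (f i) = vac (∑ i ∈ s, f i) := by
  classical
  induction s using Finset.induction_on with
  | empty =>
    have := vac_smul 0 0
    simpa using this
  | insert i s hi ih => rw [Finset.sum_insert hi, Finset.sum_insert hi, ih, vac_add]

theorem pairAnn_sectorFun (κ : ℝ) (y : Site) : pairAnn κ y (sectorFun c b) =
    vac (c (y, y) + ∑ z ∈ nn, (Real.exp (-κ) : ℂ) * c (y + z, y)) := by
  simp only [pairAnn, ann_ann, vac_smul, vac_sum, vac_add]

theorem pairCre_vac (κ : ℝ) (y : Site) (r : ℂ) : pairCre κ y (vac r) =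
    sectorFun (fun p => (if p = (y, y) then r else 0) +
      ∑ z ∈ nn, (Real.exp (-κ) : ℂ) * if p = (y + z, y) then r else 0) 0 := by
  simp only [pairCre, cre_cre_vac, sectorFun_smul, sectorFun_sum, sectorFun_add]
  congr 1
  · funext p; simp

end

section
variable (c : Site × Site → ℂ) (b : Site → ℂ)

theorem hamF_sectorFun (h U : ℝ) : hamF h U (sectorFun c b) = sectorFun (fun p =>
    (h : ℂ) * (-(1 / 2) * ((∑ z ∈ nn, c (p.1 + z, p.2)) + ∑ z ∈ nn, c (p.1, p.2 + z))
      + 4 * c p) + (U : ℂ) * if p.1 = p.2 then c p else 0) 0 := by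
  have e1 : ∀ (s : Bool) (x : Site) m n X Y, ∑ z ∈ nn,
      creF (x, s) (annF (x + z, s) (sectorFun c b)) m n X Y =
      sectorFun (fun p => if (if s then p.1 else p.2) = x then
        ∑ z ∈ nn, (if s then c (p.1 + z, p.2) else c (p.1, p.2 + z)) else 0) 0 m n X Y := by
    intro s x m n X Y
    have : ∑ z ∈ nn, creF (x, s) (annF (x + z, s) (sectorFun c b)) =
      sectorFun (fun p => if (if s then p.1 else p.2) = x then
        ∑ z ∈ nn, (if s then c (p.1 + z, p.2) else c (p.1, p.2 + z)) else 0) 0 := by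
      cases s
      · simp only [hop_down, sectorFun_sum]
        congr 1
        · funext p; simp; split_ifs with hp
          · subst hp; rfl
          · simp
        · simp
      · simp only [hop_up, sectorFun_sum]
        congr 1
        · funext p; simp; split_ifs with hp
          · subst hp; rfl
          · simp
        · simp
    rw [← this]; simp [Finset.sum_apply]
  have key : hamF h U (sectorFun c b) =
      (h : ℂ) • (-(1 / 2 : ℂ) • (∑ s : Bool, sectorFun (fun p => ∑' x : Site,
          if (if s then p.1 else p.2) = x then
          ∑ z ∈ nn, (if s then c (p.1 + z, p.2) else c (p.1, p.2 + z)) else 0) 0)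
        + (2 : ℂ) • (sectorFun (fun p => ∑' x : Site, if p.1 = x then c (x, p.2) else 0) 0 +
          sectorFun (fun p => ∑' x : Site, if p.2 = x then c (p.1, x) else 0) 0))
      + (U : ℂ) • sectorFun (fun p => ∑' x : Site, if p.1 = x then
          (if p.2 = x then c (x, x) else 0) else 0) 0 := by
    funext m n X Y
    have t0 : ∀ (f : Site → Site × Site → ℂ), ∑' x : Site, sectorFun (f x) 0 m n X Y =
        sectorFun (fun p => ∑' x, f x p) 0 m n X Y := by
      intro f
      rw [sectorFun_tsum]
      congr 1; funext x; simp
    simp only [hamF, e1, numF, hop_down, hop_up, t0, Fintype.sum_bool, Pi.add_apply,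
      Pi.smul_apply, smul_eq_mul]
  rw [key]
  simp only [Fintype.sum_bool, sectorFun_add, sectorFun_smul]
  congr 1
  · funext ⟨p, q⟩
    simp only [Pi.add_apply, Pi.smul_apply, smul_eq_mul, tsum_ite_eq', if_true, if_false,
      Bool.false_eq_true]
    by_cases hpq : p = q
    · subst hpq; simp only [if_true]; ring
    · simp only [hpq, Ne.symm hpq, if_false]; ring
  · simp

theorem hamB_sectorFun (h hb : ℝ) : hamB h hb (sectorFun c b) = sectorFun 0 (fun x =>
    (h : ℂ) * (-((hb : ℂ) / 2) * (∑ z ∈ nn, b (x + z)) + 2 * (hb : ℂ) * b x)) := by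
  have e1 : ∀ (x : Site) m n X Y, ∑ z ∈ nn, creB x (annB (x + z) (sectorFun c b)) m n X Y =
      sectorFun 0 (fun p => if p = x then ∑ z ∈ nn, b (x + z) else 0) m n X Y := by
    intro x m n X Y
    have : ∑ z ∈ nn, creB x (annB (x + z) (sectorFun c b)) =
        sectorFun 0 (fun p => if p = x then ∑ z ∈ nn, b (x + z) else 0) := by
      simp only [boson_hop, sectorFun_sum]
      congr 1
      · simp
      · funext p; simp
    rw [← this]; simp [Finset.sum_apply]
  have key : hamB h hb (sectorFun c b) =
      (h : ℂ) • (-((hb : ℂ) / 2) • sectorFun 0 (fun p => ∑' x : Site,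
          if p = x then ∑ z ∈ nn, b (x + z) else 0)
        + (2 * (hb : ℂ)) • sectorFun 0 (fun p => ∑' x : Site, if p = x then b x else 0)) := by
    funext m n X Y
    have t0 : ∀ (f : Site → Site → ℂ), ∑' x : Site, sectorFun 0 (f x) m n X Y =
        sectorFun 0 (fun p => ∑' x, f x p) m n X Y := by
      intro f
      rw [sectorFun_tsum]
      congr 1; funext x; simp
    simp only [hamB, e1]
    simp only [boson_hop, t0, Pi.add_apply, Pi.smul_apply, smul_eq_mul]
  rw [key]
  simp only [sectorFun_add, sectorFun_smul]
  congr 1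
  · simp
  · funext x
    simp

theorem exchange_sectorFun (κ : ℝ) (v : Site → ℝ) : exchange κ v (sectorFun c b) = sectorFun
    (fun p => ((if p.1 = p.2 then 1 else 0) + ∑ u ∈ nn, if p.1 = p.2 + u then
      (Real.exp (-κ) : ℂ) else 0) * ∑' z, (v z : ℂ) * b (p.2 + z))
    (fun x => ∑' z, (v z : ℂ) * (c (x - z, x - z) +
      ∑ u ∈ nn, (Real.exp (-κ) : ℂ) * c (x - z + u, x - z))) := by
  have key : exchange κ v (sectorFun c b) = sectorFun
      (fun p => ∑' x : Site, ∑' y : Site, (v (x - y) : ℂ) * ((if p = (y, y) then b x else 0) +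
        ∑ z ∈ nn, (Real.exp (-κ) : ℂ) * if p = (y + z, y) then b x else 0))
      (fun p => ∑' x : Site, ∑' y : Site, (v (x - y) : ℂ) * if p = x then
        c (y, y) + ∑ z ∈ nn, (Real.exp (-κ) : ℂ) * c (y + z, y) else 0) := by
    funext m n X Y
    have t0 : ∀ x y : Site, (v (x - y) : ℂ) *
        (creB x (pairAnn κ y (sectorFun c b)) m n X Y
          + pairCre κ y (annB x (sectorFun c b)) m n X Y) =
        sectorFun (fun p => (v (x - y) : ℂ) * ((if p = (y, y) then b x else 0) +
          ∑ z ∈ nn, (Real.exp (-κ) : ℂ) * if p = (y + z, y) then b x else 0))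
        (fun p => (v (x - y) : ℂ) * if p = x then
          c (y, y) + ∑ z ∈ nn, (Real.exp (-κ) : ℂ) * c (y + z, y) else 0) m n X Y := by
      intro x y
      rw [pairAnn_sectorFun, creB_vac, annB_sectorFun, pairCre_vac, ← Pi.add_apply, ← Pi.add_apply,
        ← Pi.add_apply, ← Pi.add_apply, sectorFun_add, zero_add, add_zero, ← smul_eq_mul,
        ← Pi.smul_apply, ← Pi.smul_apply, ← Pi.smul_apply, ← Pi.smul_apply, sectorFun_smul]
      rfl
    simp only [exchange, t0, sectorFun_tsum]
  rw [key]
  congr 1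
  · funext ⟨p, q⟩
    rw [← (Equiv.subRight q).tsum_eq (fun z => (v z : ℂ) * b (q + z)), ← tsum_mul_left]
    congr 1; funext x
    rw [tsum_eq_single q]
    · simp only [Prod.mk.injEq, and_true, Equiv.subRight_apply, add_sub_cancel, add_mul,
        Finset.sum_mul, mul_add, Finset.mul_sum]
      congr 1
      · split_ifs <;> ring
      · refine Finset.sum_congr rfl fun z _ => ?_
        split_ifs <;> ring
    · intro y hy
      simp [Ne.symm hy]
  · funext p
    rw [tsum_eq_single p]
    · rw [← (Equiv.subLeft p).tsum_eq]
      simp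
    · intro x hx
      simp [Ne.symm hx]

end

section
variable (h U hb κ : ℝ) (v : lp (fun _ : Site => ℝ) 1)

/-- Translation of the spin-up particle. -/
noncomputable def shiftUp (z : Site) : EllTwo (Site × Site) →L[ℂ] EllTwo (Site × Site) :=
  pull (fun p => (p.1 + z, p.2)) fun p q hpq => by
    simp only [Prod.mk.injEq, add_left_inj] at hpq; exact Prod.ext hpq.1 hpq.2

/-- Translation of the spin-down particle. -/
noncomputable def shiftDown (z : Site) : EllTwo (Site × Site) →L[ℂ] EllTwo (Site × Site) :=
  pull (fun p => (p.1, p.2 + z)) fun p q hpq => by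
    simp only [Prod.mk.injEq, add_left_inj] at hpq; exact Prod.ext hpq.1 hpq.2

/-- The relative-position-`u` diagonal of the pair lattice. -/
def diag (u : Site) (y : Site) : Site × Site := (y + u, y)

theorem diag_injective (u : Site) : Function.Injective (diag u) := fun _ _ h => (Prod.ext_iff.1 h).2

theorem push_diag (u : Site) (b : EllTwo Site) (p : Site × Site) :
    push (diag u) (diag_injective u) b p = if p.1 = p.2 + u then b p.2 else 0 := by
  rw [push_apply (diag u) _ b p p.2 (fun a ha => (Prod.ext_iff.1 ha).2)]
  simp [diag, Prod.ext_iff, eq_comm]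

/-- The pair-pair block. -/
noncomputable def blockPair : EllTwo (Site × Site) →L[ℂ] EllTwo (Site × Site) :=
  (h : ℂ) • (-(1 / 2 : ℂ) • (∑ z ∈ nn, shiftUp z + ∑ z ∈ nn, shiftDown z)
      + (4 : ℂ) • ContinuousLinearMap.id ℂ _)
    + (U : ℂ) • (push (diag 0) (diag_injective 0) ∘L pull (diag 0) (diag_injective 0))

/-- The boson-boson block. -/
noncomputable def blockBoson : EllTwo Site →L[ℂ] EllTwo Site :=
  (h : ℂ) • (-((hb : ℂ) / 2) • (∑ z ∈ nn, pull (fun x => x + z) (add_left_injective z))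
      + (2 * (hb : ℂ)) • ContinuousLinearMap.id ℂ _)

/-- The boson-to-pair block. -/
noncomputable def blockUp : EllTwo Site →L[ℂ] EllTwo (Site × Site) :=
  (push (diag 0) (diag_injective 0) +
    ∑ u ∈ nn, (Real.exp (-κ) : ℂ) • push (diag u) (diag_injective u)) ∘L
      conv v (fun z => Equiv.addRight z)

/-- The pair-to-boson block. -/
noncomputable def blockDown : EllTwo (Site × Site) →L[ℂ] EllTwo Site :=
  conv v (fun z => Equiv.subRight z) ∘L (pull (diag 0) (diag_injective 0) +
    ∑ u ∈ nn, (Real.exp (-κ) : ℂ) • pull (diag u) (diag_injective u))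

theorem blockPair_apply (c : EllTwo (Site × Site)) (p : Site × Site) : blockPair h U c p =
    (h : ℂ) * (-(1 / 2) * ((∑ z ∈ nn, c (p.1 + z, p.2)) + ∑ z ∈ nn, c (p.1, p.2 + z))
      + 4 * c p) + (U : ℂ) * if p.1 = p.2 then c p else 0 := by
  simp only [blockPair, add_apply, smul_apply,
    sum_apply, ContinuousLinearMap.comp_apply,
    push_diag, ContinuousLinearMap.id_apply, lp.coeFn_add, lp.coeFn_smul, lp.coeFn_sum,
    Pi.add_apply, Pi.smul_apply, Finset.sum_apply, smul_eq_mul, shiftUp, shiftDown, pull_apply,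
    diag, add_zero]
  obtain ⟨p, q⟩ := p
  by_cases hpq : p = q
  · subst hpq; rfl
  · simp only [hpq, if_false]; rfl

theorem blockBoson_apply (b : EllTwo Site) (x : Site) : blockBoson h hb b x =
    (h : ℂ) * (-((hb : ℂ) / 2) * (∑ z ∈ nn, b (x + z)) + 2 * (hb : ℂ) * b x) := by
  simp only [blockBoson, add_apply, smul_apply,
    sum_apply, ContinuousLinearMap.id_apply,
    lp.coeFn_add, lp.coeFn_smul, lp.coeFn_sum, Pi.add_apply, Pi.smul_apply, Finset.sum_apply,
    smul_eq_mul, pull_apply]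

theorem blockUp_apply (b : EllTwo Site) (p : Site × Site) : blockUp κ v b p =
    ((if p.1 = p.2 then 1 else 0) + ∑ u ∈ nn, if p.1 = p.2 + u then
      (Real.exp (-κ) : ℂ) else 0) * ∑' z, (v z : ℂ) * b (p.2 + z) := by
  simp only [blockUp, add_apply, smul_apply,
    sum_apply, ContinuousLinearMap.comp_apply,
    push_diag, lp.coeFn_add, lp.coeFn_smul, lp.coeFn_sum, conv_apply,
    Pi.add_apply, Pi.smul_apply, Finset.sum_apply, smul_eq_mul, add_zero, add_mul,
    Finset.sum_mul, ite_mul, one_mul, zero_mul, mul_ite, mul_zero, Equiv.coe_addRight]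

theorem blockDown_apply (c : EllTwo (Site × Site)) (x : Site) : blockDown κ v c x =
    ∑' z, (v z : ℂ) * (c (x - z, x - z) +
      ∑ u ∈ nn, (Real.exp (-κ) : ℂ) * c (x - z + u, x - z)) := by
  simp only [blockDown, ContinuousLinearMap.comp_apply, conv_apply]
  simp only [add_apply, smul_apply,
    sum_apply, pull_apply, lp.coeFn_add, lp.coeFn_smul,
    lp.coeFn_sum, Pi.add_apply, Pi.smul_apply, Finset.sum_apply, smul_eq_mul, diag, add_zero,
    Equiv.subRight_apply]

/-- The sector is invariant, and the full Hamiltonian acts on it as a bounded operator. -/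
theorem exists_restriction : ∃ T : Sector →L[ℂ] Sector,
    ∀ ψ, fockHamiltonian h U hb κ (fun x => v x) (embed ψ) = embed (T ψ) := by
  let e := WithLp.prodContinuousLinearEquiv 2 ℂ (EllTwo (Site × Site)) (EllTwo Site)
  refine ⟨e.symm.toContinuousLinearMap ∘L
    (((blockPair h U).coprod (blockUp κ v)).prod
      ((blockDown κ v).coprod (blockBoson h hb))) ∘L e.toContinuousLinearMap, fun ψ => ?_⟩
  rw [fockHamiltonian, embed, hamF_sectorFun, hamB_sectorFun, exchange_sectorFun,
    sectorFun_add, sectorFun_add, embed]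
  congr 1
  · funext p
    change _ = blockPair h U ψ.fst p + blockUp κ v ψ.snd p
    rw [blockPair_apply, blockUp_apply]
    simp only [Pi.add_apply, add_zero]
  · funext x
    change _ = blockDown κ v ψ.fst x + blockBoson h hb ψ.snd x
    rw [blockDown_apply, blockBoson_apply]
    simp only [Pi.add_apply, zero_add]
    ring

end

theorem embed_injective : Function.Injective embed := fun ψ φ h => by
  have h1 : ψ.fst = φ.fst := by
    ext ⟨x, y⟩
    rw [← ann_ann_embed ψ x y Fin.elim0 Fin.elim0, h, ann_ann_embed]
  have h2 : ψ.snd = φ.snd := by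
    ext x
    exact congrFun (congrFun (congrFun (congrFun h 0) 1) Fin.elim0) (fun _ => x)
  exact WithLp.ofLp_injective 2 (Prod.ext h1 h2)

/-- The Hamiltonian `H^{(2,1)}`: the restriction of the full Fock space Hamiltonian to the sector. -/
noncomputable def sectorHamiltonian (h U hb κ : ℝ) (v : lp (fun _ : Site => ℝ) 1) :
    Sector →L[ℂ] Sector :=
  Classical.choose (exists_restriction h U hb κ v)

theorem embed_sectorHamiltonian (h U hb κ : ℝ) (v : lp (fun _ : Site => ℝ) 1) (ψ : Sector) :
    embed (sectorHamiltonian h U hb κ v ψ) = fockHamiltonian h U hb κ (fun x => v x) (embed ψ) :=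
  (Classical.choose_spec (exists_restriction h U hb κ v) ψ).symm

/-! ### Spectral subspaces of bounded self-adjoint operators -/

section Spectral

variable {E : Type*} [NormedAddCommGroup E] [InnerProductSpace ℂ E] [CompleteSpace E]

open scoped ComplexInnerProductSpace CompactlySupported

/-- The positive functional `f ↦ ⟨ψ, f(A) ψ⟩` on compactly supported continuous functions. -/
noncomputable def spectralFunctional (A : E →L[ℂ] E) (ψ : E) : C_c(ℝ, ℝ) →ₚ[ℝ] ℝ :=
  PositiveLinearMap.mk₀
    { toFun := fun f => (inner ℂ ψ (cfc (f : ℝ → ℝ) A ψ)).re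
      map_add' := fun f g => by
        have : cfc ((f + g : C_c(ℝ, ℝ)) : ℝ → ℝ) A = cfc (f : ℝ → ℝ) A + cfc (g : ℝ → ℝ) A :=
          cfc_add A f g f.continuous.continuousOn g.continuous.continuousOn
        rw [this, add_apply, inner_add_right, Complex.add_re]
      map_smul' := fun r f => by
        have : cfc ((r • f : C_c(ℝ, ℝ)) : ℝ → ℝ) A = r • cfc (f : ℝ → ℝ) A :=
          cfc_smul r (f : ℝ → ℝ) A f.continuous.continuousOn
        rw [this, smul_apply]
        simp }
    (fun f hf => by
      have : 0 ≤ cfc (f : ℝ → ℝ) A := cfc_nonneg fun x _ => hf x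
      exact (ContinuousLinearMap.nonneg_iff_isPositive _).1 this |>.re_inner_nonneg_right ψ)

/-- The spectral measure `μ_ψ = ⟨ψ, 𝟏_{(·)}(A) ψ⟩` of a self-adjoint operator `A`, i.e. the measure
with `∫ f dμ_ψ = ⟨ψ, f(A) ψ⟩`. -/
noncomputable def spectralMeasure (A : E →L[ℂ] E) (ψ : E) : MeasureTheory.Measure ℝ :=
  RealRMK.rieszMeasure (spectralFunctional A ψ)

/-- The range of the spectral projection `𝟏_B(A)` of a self-adjoint operator `A`: the vectors `ψ`
with `‖𝟏_{ℝ∖B}(A) ψ‖² = μ_ψ(ℝ∖B) = 0`. -/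
def spectralRange (A : E →L[ℂ] E) (B : Set ℝ) : Set E := {ψ | spectralMeasure A ψ Bᶜ = 0}

end Spectral

/-- The bottom of the spectrum `E₀ = inf σ(H^{(2,1)})`. -/
noncomputable def groundEnergy (h U hb κ : ℝ) (v : lp (fun _ : Site => ℝ) 1) : ℝ :=
  sInf (spectrum ℝ (sectorHamiltonian h U hb κ v))

/-- The set `Ξ_ε` of norm-one `C¹` solutions of `i ∂_t ψ_t = H^{(2,1)} ψ_t` with values in the range
of the spectral projection `𝟏_{[E₀, E₀(1-ε)]}(H^{(2,1)})`. -/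
def lowEnergyEvolutions (ε h U hb κ : ℝ) (v : lp (fun _ : Site => ℝ) 1) : Set (ℝ → Sector) :=
  {ψ | ContDiff ℝ 1 ψ ∧ ∀ t : ℝ,
    Complex.I • deriv ψ t = sectorHamiltonian h U hb κ v (ψ t) ∧ ‖ψ t‖ = 1 ∧
    ψ t ∈ spectralRange (sectorHamiltonian h U hb κ v)
      (Set.Icc (groundEnergy h U hb κ v) (groundEnergy h U hb κ v * (1 - ε)))}

/-! ### Fourier transforms and orbital functions -/

/-- `k · y` for a quasi-momentum `k` and a lattice vector `y`. -/
def dotk (k : ℝ × ℝ) (y : Site) : ℝ := k.1 * y.1 + k.2 * y.2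

/-- The Fourier transform `ĝ(k) = ∑_y e^{-ik·y} g(y)`. -/
noncomputable def fourier (g : Site → ℂ) (k : ℝ × ℝ) : ℂ :=
  ∑' y : Site, Complex.exp (-(Complex.I * dotk k y)) * g y

/-- The Brillouin zone `[-π, π)²`. -/
def brillouin : Set (ℝ × ℝ) := Set.Ico (-Real.pi) Real.pi ×ˢ Set.Ico (-Real.pi) Real.pi

/-- The set `𝔎_v` of maximizers of `|v̂|` in `[-π, π)²`. -/
def maximizers (v : Site → ℝ) : Set (ℝ × ℝ) :=
  {k ∈ brillouin | ∀ q ∈ brillouin, ‖fourier (fun x => v x) q‖ ≤ ‖fourier (fun x => v x) k‖}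

/-- The function `𝐬_k(y) = ½ ∑_{|z|=1} e^{ik·z} δ_{y,z}`. -/
noncomputable def sOrbital (k : ℝ × ℝ) (y : Site) : ℂ :=
  (1 / 2) * ∑ z ∈ nn, Complex.exp (Complex.I * dotk k z) * if y = z then 1 else 0

/-- The `d`-wave orbital function `𝐝 = 𝐬_{(-π,0)}`. -/
noncomputable def dOrbital : Site → ℂ := sOrbital (-Real.pi, 0)

end DWave

/-! Write `V` for convolution with `v`, `M = ‖V‖`, `w = 2e^{-κ}M`, and `J = pairWave` for the map
that copies a function onto the four nearest-neighbour diagonals, so that `‖J g‖² = 4‖g‖²`. The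
exchange term couples `𝔠` to `e^{-κ} J V 𝔟` and, through doubly occupied sites, to `V 𝔟`. The
kinetic terms are nonnegative and `O(h)`, and the repulsion reduces the doubly occupied channel to a
cost of at most `M²/U`.

Completing the square in the remaining coupling gives `w (‖𝔠 + (2M)⁻¹ J V 𝔟‖² + ‖𝔟‖² - ‖V𝔟‖²/M²) ≤
⟨ψ, Hψ⟩ + w + M²/U` for unit vectors (`energy_lower_bound`). Trial states that make the first square
vanish show `E₀ ≤ (8 + 4h_b)h - w` (`groundEnergy_le`). Since the energy in the spectral window is
at most `E₀(1-ε)`, both nonnegative quantities on the left are small when `ε`, `h` and `1/U` are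
(`exists_low_energy_bound`). Thus `𝔠` is close to `-(2M)⁻¹ J V 𝔟`, and `𝔟` nearly maximizes `‖V𝔟‖`.

In Fourier space `V` is multiplication by `v̂`, so such a `𝔟` concentrates near the maximizers of
`|v̂|`. At either maximizer `e^{ik·y} = ±2𝐝(y)` on the nearest neighbours, with a sign depending
only on `k`; hence the multipliers `defect u`, which measure the failure of `J g` to be a `d`-wave,
vanish there. By compactness they are small on `𝔟` (`exists_multiplier_bound`), and
`exists_dWave_bound` follows with `f = dComponent 𝔠`. The argument works at each fixed time; the
evolution enters only through continuity of `f` in `t`. -/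

namespace DWave

/-! ### Energy bounds from the spectral measure and from the spectrum. -/

section Spectral

open scoped CompactlySupported

variable {E : Type*} [NormedAddCommGroup E] [InnerProductSpace ℂ E] [CompleteSpace E]

theorem integral_spectralMeasure (A : E →L[ℂ] E) (ψ : E) (f : C_c(ℝ, ℝ)) :
    ∫ x, f x ∂(spectralMeasure A ψ) = (inner ℂ ψ (cfc (f : ℝ → ℝ) A ψ)).re :=
  RealRMK.integral_rieszMeasure (spectralFunctional A ψ) f

theorem integrable_spectralMeasure (A : E →L[ℂ] E) (ψ : E) (f : C_c(ℝ, ℝ)) :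
    MeasureTheory.Integrable f (spectralMeasure A ψ) := by
  have : (spectralMeasure A ψ).Regular := RealRMK.regular_rieszMeasure _
  exact f.continuous.integrable_of_hasCompactSupport f.hasCompactSupport

/-- The energy of a vector in the range of `𝟏_{[l, u]}(A)` is at most `u`. -/
theorem re_inner_le_of_mem_spectralRange {A : E →L[ℂ] E} (hA : IsSelfAdjoint A) {l u : ℝ} {ψ : E}
    (hψ : ψ ∈ spectralRange A (Set.Icc l u)) :
    (inner ℂ ψ (A ψ)).re ≤ u * ‖ψ‖ ^ 2 := by
  -- The measure is tested only against compactly supported functions, so `1` and `x` are cut off by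
  -- a `g` equal to `1` on the compact spectrum. The functional calculus does not see the cutoff, so
  -- `g` and `x g(x)` integrate to `‖ψ‖²` and `⟨ψ, Aψ⟩`.
  obtain ⟨g, hg1, hgc, -, hg0⟩ := exists_continuousMap_one_of_isCompact_subset_isOpen
    (spectrum.isCompact (𝕜 := ℝ) A) isOpen_univ (Set.subset_univ _)
  let g' : C_c(ℝ, ℝ) := ⟨g, hgc⟩
  let f' : C_c(ℝ, ℝ) := ⟨⟨fun x => x * g x, by fun_prop⟩, HasCompactSupport.mul_left hgc⟩
  have hcg : cfc (g' : ℝ → ℝ) A = 1 := by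
    rw [← cfc_one ℝ A]
    exact cfc_congr hg1
  have hcf : cfc (f' : ℝ → ℝ) A = A := by
    conv_rhs => rw [← cfc_id ℝ A]
    refine cfc_congr fun x hx => ?_
    change x * g x = x
    rw [hg1 hx, Pi.one_apply, mul_one]
  have ig := integral_spectralMeasure A ψ g'
  have jf := integral_spectralMeasure A ψ f'
  rw [hcg, one_apply_eq_self, inner_self_eq_norm_sq_to_K] at ig
  rw [hcf] at jf
  have hn : ∫ x, g' x ∂(spectralMeasure A ψ) = ‖ψ‖ ^ 2 := by
    rw [ig]; norm_cast
  rw [← jf, ← hn, ← MeasureTheory.integral_const_mul]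
  refine MeasureTheory.integral_mono_ae (integrable_spectralMeasure A ψ f')
    ((integrable_spectralMeasure A ψ g').const_mul u) ?_
  have hae : ∀ᵐ x ∂(spectralMeasure A ψ), x ∈ Set.Icc l u :=
    MeasureTheory.mem_ae_iff.2 hψ
  filter_upwards [hae] with x hx
  exact mul_le_mul_of_nonneg_right hx.2 (hg0 x).1

theorem sInf_spectrum_mul_norm_sq_le {A : E →L[ℂ] E} (hA : IsSelfAdjoint A) (ψ : E) :
    sInf (spectrum ℝ A) * ‖ψ‖ ^ 2 ≤ (inner ℂ ψ (A ψ)).re := by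
  have h1 : algebraMap ℝ (E →L[ℂ] E) (sInf (spectrum ℝ A)) ≤ A := by
    rw [algebraMap_le_iff_le_spectrum]
    intro x hx
    exact csInf_le (spectrum.isCompact A).bddBelow hx
  have h2 := ((ContinuousLinearMap.le_def _ _).1 h1).re_inner_nonneg_right ψ
  have h3 : (algebraMap ℝ (E →L[ℂ] E) (sInf (spectrum ℝ A))) ψ =
      ((sInf (spectrum ℝ A) : ℝ) : ℂ) • ψ := by
    rw [Algebra.algebraMap_eq_smul_one, smul_apply, one_apply_eq_self, Complex.coe_smul]
  rw [sub_apply, inner_sub_right, h3, inner_smul_right, inner_self_eq_norm_sq_to_K] at h2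
  have h4 : RCLike.re (inner ℂ ψ (A ψ) - ((sInf (spectrum ℝ A) : ℝ) : ℂ) * ((‖ψ‖ : ℝ) : ℂ) ^ 2)
      = (inner ℂ ψ (A ψ)).re - sInf (spectrum ℝ A) * ‖ψ‖ ^ 2 := by
    rw [← Complex.ofReal_pow, ← Complex.ofReal_mul]
    exact (Complex.sub_re _ _).trans (by rw [Complex.ofReal_re])
  exact sub_nonneg.1 (h2.trans_eq h4)

end Spectral
-- Translations, diagonals and convolutions on `ℓ²`.
section Shift

/-- Translation by `z` on `ℓ²(ℤ²)`. -/
noncomputable abbrev trans (z : Site) : EllTwo Site →L[ℂ] EllTwo Site :=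
  pull (fun x => x + z) (add_left_injective z)

theorem norm_pull_apply_le {α β : Type} (f : α → β) (hf : Function.Injective f) (c : EllTwo β) :
    ‖pull f hf c‖ ≤ ‖c‖ :=
  ((pull f hf).le_of_opNorm_le (norm_pull_le f hf) c).trans_eq (one_mul _)

theorem norm_push_apply_le {α β : Type} (f : α → β) (hf : Function.Injective f) (b : EllTwo α) :
    ‖push f hf b‖ ≤ ‖b‖ := by
  refine ((push f hf).le_of_opNorm_le ?_ b).trans_eq (one_mul _)
  rw [push, LinearIsometryEquiv.norm_map]
  exact norm_pull_le f hf

theorem pull_equiv_adjoint {α β : Type} (e : α ≃ β) :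
    ContinuousLinearMap.adjoint (pull e e.injective) = pull e.symm e.symm.injective := by
  classical
  ext b y
  change push e e.injective b y = _
  rw [push_apply e e.injective b y (e.symm y) (fun a ha => by simp [← ha])]
  simp [pull_apply]

theorem norm_pull_equiv {α β : Type} (e : α ≃ β) (c : EllTwo β) :
    ‖pull e e.injective c‖ = ‖c‖ := by
  refine le_antisymm (norm_pull_apply_le _ _ _) ?_
  have : pull e.symm e.symm.injective (pull e e.injective c) = c := by
    ext y; simp [pull_apply]
  conv_lhs => rw [← this]
  exact norm_pull_apply_le _ _ _

/-- Distinct diagonals of the pair lattice are disjoint, so functions extended from them are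
orthogonal. -/
theorem pull_diag_push_diag (u u' : Site) (b : EllTwo Site) :
    pull (diag u) (diag_injective u) (push (diag u') (diag_injective u') b) =
      if u = u' then b else 0 := by
  ext y
  rw [pull_apply, push_diag]
  split_ifs with h1 h2 h2
  · rfl
  · exact absurd (by simpa [diag] using h1) h2
  · subst h2; simp [diag] at h1
  · rfl

theorem summable_norm_coeff (v : lp (fun _ : Site => ℝ) 1) : Summable fun z => ‖v z‖ := by
  simpa using (lp.memℓp v).summable (by norm_num)

theorem hasSum_conv (v : lp (fun _ : Site => ℝ) 1) (e : Site → Site ≃ Site) :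
    HasSum (fun z => (v z : ℂ) • pull (e z) (e z).injective) (conv v e) := by
  refine (Summable.of_norm_bounded (summable_norm_coeff v) fun z => ?_).hasSum
  rw [norm_smul]
  calc _ ≤ ‖(v z : ℂ)‖ * 1 := by gcongr; exact norm_pull_le _ _
    _ = _ := by simp

/-- Translations are unitary and the coefficients are real, so the adjoint reverses each
translation. The adjoint is continuous and passes through the norm-convergent series. -/
theorem conv_adjoint (v : lp (fun _ : Site => ℝ) 1) :
    ContinuousLinearMap.adjoint (conv v fun z => Equiv.addRight z) =
      conv v fun z => Equiv.subRight z := by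
  have h := (hasSum_conv v fun z => Equiv.addRight z).map
    (ContinuousLinearMap.adjoint (𝕜 := ℂ) (E := EllTwo Site) (F := EllTwo Site))
    (LinearIsometryEquiv.continuous _)
  refine h.unique ((hasSum_conv v fun z => Equiv.subRight z).congr_fun fun z => ?_)
  change ContinuousLinearMap.adjoint ((v z : ℂ) • pull (Equiv.addRight z) _) = _
  rw [map_smulₛₗ, pull_equiv_adjoint, Complex.conj_ofReal]
  rfl

theorem conv_trans (v : lp (fun _ : Site => ℝ) 1) (u : Site) (b : EllTwo Site) :
    conv v (fun z => Equiv.addRight z) (trans u b) = trans u (conv v (fun z => Equiv.addRight z) b) := by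
  ext x
  simp only [conv_apply, pull_apply, Equiv.coe_addRight, add_right_comm]

end Shift

/-! ### Self-adjointness and quadratic form of the sector Hamiltonian. -/

section Blocks

variable (h U hb κ : ℝ) (v : lp (fun _ : Site => ℝ) 1)

theorem blockUp_adjoint : ContinuousLinearMap.adjoint (blockUp κ v) = blockDown κ v := by
  simp only [blockUp, blockDown, ContinuousLinearMap.adjoint_comp, conv_adjoint, map_add, map_sum,
    map_smulₛₗ, push, ContinuousLinearMap.adjoint_adjoint, Complex.conj_ofReal]

end Blocks
theorem sum_nn {M : Type*} [AddCommMonoid M] (f : Site → M) :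
    ∑ z ∈ nn, f z = f (1, 0) + f (-1, 0) + f (0, 1) + f (0, -1) := by
  rw [nn, Finset.sum_insert (by decide), Finset.sum_insert (by decide),
    Finset.sum_insert (by decide), Finset.sum_singleton]
  simp only [add_assoc]

theorem sum_nn_neg {M : Type*} [AddCommMonoid M] (f : Site → M) :
    ∑ z ∈ nn, f (-z) = ∑ z ∈ nn, f z := by
  simp only [sum_nn, Prod.neg_mk, neg_zero, neg_neg]
  abel

section Hamiltonian

variable (h U hb κ : ℝ) (v : lp (fun _ : Site => ℝ) 1)

/-- The operator is known only through its action after `embed`; injectivity of `embed` identifies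
it with the explicit block matrix. -/
theorem sectorHamiltonian_apply (ψ : Sector) : sectorHamiltonian h U hb κ v ψ =
    WithLp.toLp 2 (blockPair h U ψ.fst + blockUp κ v ψ.snd,
      blockDown κ v ψ.fst + blockBoson h hb ψ.snd) := by
  apply embed_injective
  rw [embed_sectorHamiltonian, fockHamiltonian, embed, hamF_sectorFun, hamB_sectorFun,
    exchange_sectorFun, sectorFun_add, sectorFun_add, embed]
  congr 1
  · funext p
    change _ = blockPair h U ψ.fst p + blockUp κ v ψ.snd p
    rw [blockPair_apply, blockUp_apply]
    simp only [Pi.add_apply, add_zero]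
  · funext x
    change _ = blockDown κ v ψ.fst x + blockBoson h hb ψ.snd x
    rw [blockDown_apply, blockBoson_apply]
    simp only [Pi.add_apply, zero_add]
    ring

theorem shiftUp_adjoint (z : Site) :
    ContinuousLinearMap.adjoint (shiftUp z) = shiftUp (-z) :=
  pull_equiv_adjoint ((Equiv.addRight z).prodCongr (Equiv.refl Site))

theorem shiftDown_adjoint (z : Site) :
    ContinuousLinearMap.adjoint (shiftDown z) = shiftDown (-z) :=
  pull_equiv_adjoint ((Equiv.refl Site).prodCongr (Equiv.addRight z))

theorem trans_adjoint (z : Site) :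
    ContinuousLinearMap.adjoint (trans z) = trans (-z) :=
  pull_equiv_adjoint (Equiv.addRight z)

theorem blockPair_adjoint : ContinuousLinearMap.adjoint (blockPair h U) = blockPair h U := by
  have h1 : starRingEnd ℂ (-(1 / 2)) = -(1 / 2) := by
    rw [show (-(1 / 2) : ℂ) = ((-(1 / 2) : ℝ) : ℂ) by push_cast; ring, Complex.conj_ofReal]
  have h4 : starRingEnd ℂ 4 = 4 := Complex.conj_ofReal 4
  have hid : ContinuousLinearMap.adjoint (ContinuousLinearMap.id ℂ (EllTwo (Site × Site))) =
      ContinuousLinearMap.id ℂ _ := ContinuousLinearMap.adjoint_id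
  simp only [blockPair, map_add, map_sum, map_smulₛₗ, ContinuousLinearMap.adjoint_comp, push,
    ContinuousLinearMap.adjoint_adjoint, Complex.conj_ofReal, shiftUp_adjoint, shiftDown_adjoint,
    sum_nn_neg shiftUp, sum_nn_neg shiftDown, h1, h4, hid]

theorem blockBoson_adjoint : ContinuousLinearMap.adjoint (blockBoson h hb) = blockBoson h hb := by
  have h1 : starRingEnd ℂ (-((hb : ℂ) / 2)) = -((hb : ℂ) / 2) := by
    rw [show (-((hb : ℂ) / 2) : ℂ) = ((-(hb / 2) : ℝ) : ℂ) by push_cast; ring,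
      Complex.conj_ofReal]
  have h2 : starRingEnd ℂ (2 * (hb : ℂ)) = 2 * (hb : ℂ) := by
    rw [show (2 * (hb : ℂ) : ℂ) = ((2 * hb : ℝ) : ℂ) by push_cast; ring, Complex.conj_ofReal]
  have hid : ContinuousLinearMap.adjoint (ContinuousLinearMap.id ℂ (EllTwo Site)) =
      ContinuousLinearMap.id ℂ _ := ContinuousLinearMap.adjoint_id
  simp only [blockBoson, map_add, map_sum, map_smulₛₗ, Complex.conj_ofReal, trans_adjoint,
    sum_nn_neg trans, h1, h2, hid]

/-- The diagonal blocks are self-adjoint because the neighbour set is invariant under `z ↦ -z`; the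
off-diagonal blocks are adjoint to each other. -/
theorem isSelfAdjoint_sectorHamiltonian : IsSelfAdjoint (sectorHamiltonian h U hb κ v) := by
  rw [ContinuousLinearMap.isSelfAdjoint_iff_isSymmetric]
  intro ψ φ
  have e1 : ∀ x y, inner ℂ (blockPair h U x) y = inner ℂ x (blockPair h U y) := fun x y => by
    rw [← ContinuousLinearMap.adjoint_inner_right, blockPair_adjoint]
  have e2 : ∀ x y, inner ℂ (blockBoson h hb x) y = inner ℂ x (blockBoson h hb y) := fun x y => by
    rw [← ContinuousLinearMap.adjoint_inner_right, blockBoson_adjoint]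
  have e3 : ∀ x y, inner ℂ (blockUp κ v x) y = inner ℂ x (blockDown κ v y) := fun x y => by
    rw [← ContinuousLinearMap.adjoint_inner_right, blockUp_adjoint]
  have e4 : ∀ x y, inner ℂ (blockDown κ v x) y = inner ℂ x (blockUp κ v y) := fun x y => by
    rw [← blockUp_adjoint, ContinuousLinearMap.adjoint_inner_left]
  change inner ℂ (sectorHamiltonian h U hb κ v ψ) φ = inner ℂ ψ (sectorHamiltonian h U hb κ v φ)
  rw [sectorHamiltonian_apply, sectorHamiltonian_apply]
  simp only [WithLp.prod_inner_apply, inner_add_left, inner_add_right, e1, e2]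
  change inner ℂ ψ.fst (blockPair h U φ.fst) + inner ℂ (blockUp κ v ψ.snd) φ.fst +
    (inner ℂ (blockDown κ v ψ.fst) φ.snd + inner ℂ ψ.snd (blockBoson h hb φ.snd)) =
    inner ℂ ψ.fst (blockPair h U φ.fst) + inner ℂ ψ.fst (blockUp κ v φ.snd) +
    (inner ℂ ψ.snd (blockDown κ v φ.fst) + inner ℂ ψ.snd (blockBoson h hb φ.snd))
  rw [e3, e4]
  abel

theorem re_inner_sectorHamiltonian (ψ : Sector) :
    (inner ℂ ψ (sectorHamiltonian h U hb κ v ψ)).re =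
      (inner ℂ ψ.fst (blockPair h U ψ.fst)).re + (inner ℂ ψ.snd (blockBoson h hb ψ.snd)).re +
        2 * (inner ℂ ψ.fst (blockUp κ v ψ.snd)).re := by
  have e : (inner ℂ ψ.snd (blockDown κ v ψ.fst)).re = (inner ℂ ψ.fst (blockUp κ v ψ.snd)).re := by
    rw [← blockUp_adjoint, ContinuousLinearMap.adjoint_inner_right, ← inner_conj_symm,
      Complex.conj_re]
  rw [sectorHamiltonian_apply, WithLp.prod_inner_apply]
  change (inner ℂ ψ.fst (_ + _) + inner ℂ ψ.snd (_ + _)).re = _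
  rw [inner_add_right, inner_add_right, Complex.add_re, Complex.add_re, Complex.add_re, e]
  ring

theorem abs_re_inner_pull_le {α : Type} (f : α → α) (hf : Function.Injective f) (c : EllTwo α) :
    |(inner ℂ c (pull f hf c)).re| ≤ ‖c‖ ^ 2 := by
  refine (Complex.abs_re_le_norm _).trans ((norm_inner_le_norm _ _).trans ?_)
  rw [pow_two]
  exact mul_le_mul_of_nonneg_left (norm_pull_apply_le _ _ _) (norm_nonneg _)

theorem inner_self_re {α : Type} (c : EllTwo α) : (inner ℂ c c).re = ‖c‖ ^ 2 :=
  inner_self_eq_norm_sq (𝕜 := ℂ) c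

theorem re_inner_blockPair (c : EllTwo (Site × Site)) : (inner ℂ c (blockPair h U c)).re =
    h * (4 * ‖c‖ ^ 2 - 1 / 2 * (∑ z ∈ nn, (inner ℂ c (shiftUp z c)).re +
      ∑ z ∈ nn, (inner ℂ c (shiftDown z c)).re)) +
      U * ‖pull (diag 0) (diag_injective 0) c‖ ^ 2 := by
  simp only [blockPair, push, add_apply, smul_apply, sum_apply, ContinuousLinearMap.comp_apply,
    ContinuousLinearMap.id_apply, inner_add_right, inner_smul_right, inner_sum,
    ContinuousLinearMap.adjoint_inner_right, Complex.add_re, Complex.re_ofReal_mul]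
  rw [inner_self_re]
  rw [show (-(1 / 2) : ℂ) = ((-(1 / 2) : ℝ) : ℂ) by push_cast; ring,
    show (4 : ℂ) = ((4 : ℝ) : ℂ) by push_cast; ring]
  rw [Complex.re_ofReal_mul, Complex.re_ofReal_mul, inner_self_re, Complex.add_re, Complex.re_sum,
    Complex.re_sum]
  ring

theorem re_inner_blockBoson (b : EllTwo Site) : (inner ℂ b (blockBoson h hb b)).re =
    h * hb * (2 * ‖b‖ ^ 2 - 1 / 2 * ∑ z ∈ nn, (inner ℂ b (trans z b)).re) := by
  simp only [blockBoson, add_apply, smul_apply, sum_apply,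
    ContinuousLinearMap.id_apply, inner_add_right, inner_smul_right, inner_sum,
    Complex.re_ofReal_mul, Complex.add_re]
  rw [show (-((hb : ℂ) / 2) : ℂ) = ((-(hb / 2) : ℝ) : ℂ) by push_cast; ring,
    show (2 * (hb : ℂ) : ℂ) = ((2 * hb : ℝ) : ℂ) by push_cast; ring]
  rw [Complex.re_ofReal_mul, Complex.re_ofReal_mul, inner_self_re, Complex.re_sum]
  ring

variable {h hb}

theorem abs_sum_nn_le {f : Site → ℝ} {B : ℝ} (hf : ∀ z, |f z| ≤ B) :
    |∑ z ∈ nn, f z| ≤ 4 * B := by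
  refine (Finset.abs_sum_le_sum_abs _ _).trans ((Finset.sum_le_card_nsmul nn _ B fun z _ => hf z).trans ?_)
  rw [show nn.card = 4 from rfl]; simp

/-- Eight translations of norm at most one, weighted by `1/2`, compete with the diagonal term `4`.
So the kinetic energy lies between `0` and `8h‖c‖²`, which yields this bound and the next one. -/
theorem le_re_inner_blockPair (hh : 0 ≤ h) (c : EllTwo (Site × Site)) :
    U * ‖pull (diag 0) (diag_injective 0) c‖ ^ 2 ≤ (inner ℂ c (blockPair h U c)).re := by
  rw [re_inner_blockPair]
  have h1 := (abs_le.1 (abs_sum_nn_le fun z => abs_re_inner_pull_le _ _ c :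
    |∑ z ∈ nn, (inner ℂ c (shiftUp z c)).re| ≤ 4 * ‖c‖ ^ 2)).2
  have h2 := (abs_le.1 (abs_sum_nn_le fun z => abs_re_inner_pull_le _ _ c :
    |∑ z ∈ nn, (inner ℂ c (shiftDown z c)).re| ≤ 4 * ‖c‖ ^ 2)).2
  exact le_add_of_nonneg_left (mul_nonneg hh (by linarith))

theorem re_inner_blockPair_le (hh : 0 ≤ h) (c : EllTwo (Site × Site)) :
    (inner ℂ c (blockPair h U c)).re ≤
      h * (8 * ‖c‖ ^ 2) + U * ‖pull (diag 0) (diag_injective 0) c‖ ^ 2 := by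
  rw [re_inner_blockPair]
  have h1 := (abs_le.1 (abs_sum_nn_le fun z => abs_re_inner_pull_le _ _ c :
    |∑ z ∈ nn, (inner ℂ c (shiftUp z c)).re| ≤ 4 * ‖c‖ ^ 2)).1
  have h2 := (abs_le.1 (abs_sum_nn_le fun z => abs_re_inner_pull_le _ _ c :
    |∑ z ∈ nn, (inner ℂ c (shiftDown z c)).re| ≤ 4 * ‖c‖ ^ 2)).1
  gcongr
  linarith

theorem re_inner_blockBoson_nonneg (hh : 0 ≤ h) (hhb : 0 ≤ hb) (b : EllTwo Site) :
    0 ≤ (inner ℂ b (blockBoson h hb b)).re := by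
  rw [re_inner_blockBoson]
  have h1 := (abs_le.1 (abs_sum_nn_le fun z => abs_re_inner_pull_le _ _ b :
    |∑ z ∈ nn, (inner ℂ b (trans z b)).re| ≤ 4 * ‖b‖ ^ 2)).2
  exact mul_nonneg (mul_nonneg hh hhb) (by linarith)

theorem re_inner_blockBoson_le (hh : 0 ≤ h) (hhb : 0 ≤ hb) (b : EllTwo Site) :
    (inner ℂ b (blockBoson h hb b)).re ≤ h * (4 * hb * ‖b‖ ^ 2) := by
  rw [re_inner_blockBoson]
  have h1 := (abs_le.1 (abs_sum_nn_le fun z => abs_re_inner_pull_le _ _ b :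
    |∑ z ∈ nn, (inner ℂ b (trans z b)).re| ≤ 4 * ‖b‖ ^ 2)).1
  calc _ ≤ h * hb * (4 * ‖b‖ ^ 2) :=
        mul_le_mul_of_nonneg_left (by linarith) (mul_nonneg hh hhb)
    _ = _ := by ring

end Hamiltonian
-- Two-sided energy estimates.
section Energy

/-- The form factor `V = v(· - x)` of the exchange interaction. -/
noncomputable abbrev formFactor (v : lp (fun _ : Site => ℝ) 1) : EllTwo Site →L[ℂ] EllTwo Site :=
  conv v fun z => Equiv.addRight z

/-- The pair wave function with the same amplitude on each of the four nearest-neighbour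
diagonals. -/
noncomputable def pairWave : EllTwo Site →L[ℂ] EllTwo (Site × Site) :=
  ∑ u ∈ nn, push (diag u) (diag_injective u)

theorem pull_diag_pairWave (u : Site) (g : EllTwo Site) :
    pull (diag u) (diag_injective u) (pairWave g) = if u ∈ nn then g else 0 := by
  rw [pairWave, sum_apply, map_sum]
  simp only [pull_diag_push_diag]
  rw [Finset.sum_ite_eq]

theorem inner_pairWave (c : EllTwo (Site × Site)) (g : EllTwo Site) :
    inner ℂ c (pairWave g) = ∑ u ∈ nn, inner ℂ (pull (diag u) (diag_injective u) c) g := by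
  rw [pairWave, sum_apply, inner_sum]
  simp only [push, ContinuousLinearMap.adjoint_inner_right]

theorem norm_pairWave_sq (g : EllTwo Site) : ‖pairWave g‖ ^ 2 = 4 * ‖g‖ ^ 2 := by
  rw [← inner_self_re, inner_pairWave, Finset.sum_congr rfl fun u hu => by
    rw [pull_diag_pairWave, if_pos hu]]
  rw [Finset.sum_const, show nn.card = 4 from rfl]
  simp only [nsmul_eq_mul, Nat.cast_ofNat]
  rw [show (4 : ℂ) = ((4 : ℝ) : ℂ) by push_cast; ring, Complex.re_ofReal_mul, inner_self_re]

theorem norm_add_smul_pairWave_sq (c : EllTwo (Site × Site)) (g : EllTwo Site) (r : ℝ) :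
    ‖c + (r : ℂ) • pairWave g‖ ^ 2 =
      ‖c‖ ^ 2 + 2 * r * (inner ℂ c (pairWave g)).re + 4 * r ^ 2 * ‖g‖ ^ 2 := by
  have h1 := norm_add_sq (𝕜 := ℂ) c ((r : ℂ) • pairWave g)
  have h2 : RCLike.re (inner ℂ c ((r : ℂ) • pairWave g)) = r * (inner ℂ c (pairWave g)).re := by
    rw [inner_smul_right]
    exact Complex.re_ofReal_mul _ _
  rw [h1, h2, norm_smul, mul_pow, norm_pairWave_sq, Complex.norm_real, Real.norm_eq_abs, sq_abs]
  ring

variable {h U hb κ : ℝ} (v : lp (fun _ : Site => ℝ) 1)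

/-- Separates the on-site channel, which the repulsion suppresses, from the nearest-neighbour
channel, which selects the low-energy states. -/
theorem re_inner_blockUp (c : EllTwo (Site × Site)) (b : EllTwo Site) :
    (inner ℂ c (blockUp κ v b)).re =
      (inner ℂ (pull (diag 0) (diag_injective 0) c) (formFactor v b)).re +
        Real.exp (-κ) * (inner ℂ c (pairWave (formFactor v b))).re := by
  have : blockUp κ v b = push (diag 0) (diag_injective 0) (formFactor v b) +
      (Real.exp (-κ) : ℂ) • pairWave (formFactor v b) := by
    simp only [blockUp, pairWave, ContinuousLinearMap.comp_apply, add_apply, sum_apply, smul_apply,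
      Finset.smul_sum]
  rw [this, inner_add_right, inner_smul_right, Complex.add_re, Complex.re_ofReal_mul, push,
    ContinuousLinearMap.adjoint_inner_right]

theorem sector_norm_sq (ψ : Sector) : ‖ψ‖ ^ 2 = ‖ψ.fst‖ ^ 2 + ‖ψ.snd‖ ^ 2 :=
  WithLp.prod_norm_sq_eq_of_L2 ψ

/-- Lower bound on the energy in terms of the distance to the pair waves generated by bosons whose
momenta maximize the form factor. -/
theorem energy_lower_bound (hh : 0 ≤ h) (hhb : 0 ≤ hb) (hU : 0 < U) (hM : 0 < ‖formFactor v‖)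
    {ψ : Sector} (hψ : ‖ψ‖ = 1) :
    2 * Real.exp (-κ) * ‖formFactor v‖ *
      (‖ψ.fst + ((1 / (2 * ‖formFactor v‖) : ℝ) : ℂ) • pairWave (formFactor v ψ.snd)‖ ^ 2 +
        (‖ψ.snd‖ ^ 2 - ‖formFactor v ψ.snd‖ ^ 2 / ‖formFactor v‖ ^ 2)) ≤
    (inner ℂ ψ (sectorHamiltonian h U hb κ v ψ)).re +
      2 * Real.exp (-κ) * ‖formFactor v‖ + ‖formFactor v‖ ^ 2 / U := by
  have hn := sector_norm_sq ψ
  rw [hψ] at hn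
  rw [re_inner_sectorHamiltonian, re_inner_blockUp, norm_add_smul_pairWave_sq]
  set M := ‖formFactor v‖
  set c := ψ.fst
  set b := ψ.snd
  set c0 := pull (diag 0) (diag_injective 0) c with hc0
  set X := (inner ℂ c (pairWave (formFactor v b))).re
  have h1 := le_re_inner_blockPair (U := U) hh c
  have h2 := re_inner_blockBoson_nonneg hh hhb b
  have hb1 : ‖b‖ ≤ 1 := by nlinarith [norm_nonneg b, sq_nonneg ‖c‖]
  have h3 : -(‖c0‖ * M) ≤ (inner ℂ c0 (formFactor v b)).re := by
    refine (abs_le.1 ((Complex.abs_re_le_norm _).trans ((norm_inner_le_norm _ _).trans ?_))).1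
    refine mul_le_mul_of_nonneg_left ?_ (norm_nonneg _)
    exact ((formFactor v).le_opNorm b).trans (mul_le_of_le_one_right hM.le hb1)
  -- The repulsion absorbs the on-site coupling; completing the square in `‖c0‖` is the source of
  -- the error `M²/U`.
  have h4 : 0 ≤ U * ‖c0‖ ^ 2 - 2 * (‖c0‖ * M) + M ^ 2 / U := by
    have : U * ‖c0‖ ^ 2 - 2 * (‖c0‖ * M) + M ^ 2 / U = U * (‖c0‖ - M / U) ^ 2 := by
      field_simp; ring
    rw [this]; positivity
  -- The factor `1/(2M)` makes the quadratic term `4(2M)⁻²‖V𝔟‖²` cancel `‖V𝔟‖²/M²`; what remains is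
  -- `w‖ψ‖²` plus the nearest-neighbour coupling.
  have h5 : 2 * Real.exp (-κ) * M * (‖c‖ ^ 2 + 2 * (1 / (2 * M)) * X +
      4 * (1 / (2 * M)) ^ 2 * ‖formFactor v b‖ ^ 2 +
      (‖b‖ ^ 2 - ‖formFactor v b‖ ^ 2 / M ^ 2)) =
      2 * Real.exp (-κ) * M * (‖c‖ ^ 2 + ‖b‖ ^ 2) + 2 * (Real.exp (-κ) * X) := by
    field_simp; ring
  rw [h5, ← hn]
  linarith

/-- Upper bound on the ground state energy from the trial functions `𝔠 = -(2M)⁻¹ J V 𝔟`. -/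
theorem groundEnergy_le (hh : 0 ≤ h) (hhb : 0 ≤ hb) (hM : 0 < ‖formFactor v‖) :
    groundEnergy h U hb κ v ≤ (8 + 4 * hb) * h - 2 * Real.exp (-κ) * ‖formFactor v‖ := by
  set M := ‖formFactor v‖ with hMdef
  set a := Real.exp (-κ)
  have ha : 0 < a := Real.exp_pos _
  by_contra! hlt
  set τ := groundEnergy h U hb κ v - ((8 + 4 * hb) * h - 2 * a * M) with hτ
  have hτ0 : 0 < τ := sub_pos.2 hlt
  -- Were the claim to fail by `τ > 0`, the variational principle applied to every trial state would
  -- bound `‖V b‖` by a constant strictly below `M` times `‖b‖`, contradicting `M = ‖V‖`. No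
  -- near-maximizer has to be selected.
  have key : ∀ b : EllTwo Site, (2 * a * M + τ) * ‖formFactor v b‖ ^ 2 ≤
      2 * a * M * M ^ 2 * ‖b‖ ^ 2 := by
    intro b
    let c : EllTwo (Site × Site) := ((-(1 / (2 * M)) : ℝ) : ℂ) • pairWave (formFactor v b)
    let ψ : Sector := WithLp.toLp 2 (c, b)
    have h1 := sInf_spectrum_mul_norm_sq_le (isSelfAdjoint_sectorHamiltonian h U hb κ v) ψ
    -- The trial pair has no double occupancy, since `0` is not a nearest neighbour; hence the bound
    -- does not involve `U`.
    have hc0 : pull (diag 0) (diag_injective 0) c = 0 := by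
      simp only [c]
      rw [map_smul, pull_diag_pairWave, if_neg (by decide), smul_zero]
    have hcn : ‖c‖ ^ 2 = ‖formFactor v b‖ ^ 2 / M ^ 2 := by
      have := norm_add_smul_pairWave_sq 0 (formFactor v b) (-(1 / (2 * M)))
      rw [zero_add] at this
      rw [this, inner_zero_left, norm_zero, Complex.zero_re]
      field_simp; ring
    have hcX : (inner ℂ c (pairWave (formFactor v b))).re = -(2 / M * ‖formFactor v b‖ ^ 2) := by
      simp only [c]
      rw [inner_smul_left, Complex.conj_ofReal, Complex.re_ofReal_mul, inner_self_re,
        norm_pairWave_sq]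
      field_simp; ring
    rw [re_inner_sectorHamiltonian, re_inner_blockUp, sector_norm_sq] at h1
    change groundEnergy h U hb κ v * (‖c‖ ^ 2 + ‖b‖ ^ 2) ≤ (inner ℂ c (blockPair h U c)).re +
      (inner ℂ b (blockBoson h hb b)).re +
      2 * ((inner ℂ (pull (diag 0) (diag_injective 0) c) (formFactor v b)).re +
        a * (inner ℂ c (pairWave (formFactor v b))).re) at h1
    have h2 := re_inner_blockPair_le U hh c
    have h3 := re_inner_blockBoson_le hh hhb b
    rw [hc0, norm_zero] at h2
    rw [hc0, inner_zero_left, Complex.zero_re, hcX] at h1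
    have hE : groundEnergy h U hb κ v = (8 + 4 * hb) * h - 2 * a * M + τ := by rw [hτ]; ring
    have h4 : 0 ≤ h * (hb * ‖c‖ ^ 2) := by positivity
    have h5 : 0 ≤ h * ‖b‖ ^ 2 := by positivity
    have h6 : ‖formFactor v b‖ ^ 2 = M ^ 2 * ‖c‖ ^ 2 := by rw [hcn]; field_simp
    have h7 : 2 / M * ‖formFactor v b‖ ^ 2 = 2 * M * ‖c‖ ^ 2 := by rw [h6]; field_simp
    rw [hE, h7] at h1
    have h8 : (2 * a * M + τ) * ‖c‖ ^ 2 ≤ 2 * a * M * ‖b‖ ^ 2 := by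
      have : 0 ≤ τ * ‖b‖ ^ 2 := by positivity
      linarith
    rw [h6]
    have := mul_le_mul_of_nonneg_left h8 (sq_nonneg M)
    linarith
  have hpos : 0 < 2 * a * M := by positivity
  have hle : M ≤ Real.sqrt (2 * a * M / (2 * a * M + τ)) * M := by
    refine (formFactor v).opNorm_le_bound (by positivity) fun b => ?_
    refine abs_le_of_sq_le_sq' ?_ (by positivity) |>.2
    rw [mul_pow, mul_pow, Real.sq_sqrt (by positivity), div_mul_eq_mul_div, div_mul_eq_mul_div,
      le_div_iff₀ (by positivity)]
    linarith [key b]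
  have hlt1 : Real.sqrt (2 * a * M / (2 * a * M + τ)) < 1 := by
    rw [Real.sqrt_lt' one_pos, one_pow, div_lt_one (by positivity)]
    linarith
  nlinarith

end Energy
-- Fourier multipliers on the torus.
open UnitAddTorus MeasureTheory

section Torus

attribute [local instance] instMeasureSpaceUnitAddCircle

-- Full support of Haar measure is what later turns almost-everywhere equality of continuous
-- functions into equality.
local instance : Measure.IsAddHaarMeasure (volume : Measure UnitAddCircle) :=
  inferInstanceAs (Measure.IsAddHaarMeasure AddCircle.haarAddCircle)

local instance : IsProbabilityMeasure (volume : Measure UnitAddCircle) :=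
  inferInstanceAs (IsProbabilityMeasure AddCircle.haarAddCircle)

/-- The two-dimensional torus of quasi-momenta, in units of `2π`. -/
abbrev Torus := UnitAddTorus (Fin 2)

/-- Lattice sites as families indexed by `Fin 2`. -/
def siteEquiv : Site ≃ (Fin 2 → ℤ) := (finTwoArrowEquiv ℤ).symm

/-- The character `k ↦ e^{-ik·z}` of the torus. -/
noncomputable def chr (z : Site) : C(Torus, ℂ) := mFourier (-siteEquiv z)

theorem chr_coe (z : Site) (k : ℝ × ℝ) :
    chr z ![((k.1 / (2 * Real.pi) : ℝ) : UnitAddCircle), ((k.2 / (2 * Real.pi) : ℝ) : UnitAddCircle)] =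
      Complex.exp (-(Complex.I * dotk k z)) := by
  have hpi : (Real.pi : ℂ) ≠ 0 := by exact_mod_cast Real.pi_ne_zero
  simp only [chr, mFourier, ContinuousMap.coe_mk, Fin.prod_univ_two, siteEquiv,
    finTwoArrowEquiv_symm_apply, Pi.neg_apply, Matrix.cons_val_zero, Matrix.cons_val_one,
    fourier_coe_apply, ← Complex.exp_add, dotk]
  congr 1
  push_cast
  field_simp
  ring

theorem exists_brillouin (t : Torus) :
    ∃ k ∈ brillouin, ∀ z, chr z t = Complex.exp (-(Complex.I * dotk k z)) := by
  have h : ∀ s : UnitAddCircle, ∃ x ∈ Set.Ico (-Real.pi) Real.pi,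
      ((x / (2 * Real.pi) : ℝ) : UnitAddCircle) = s := by
    intro s
    -- The fundamental domain starts at `-1/2` so that scaling by `2π` lands in `[-π, π)`.
    obtain ⟨y, hy⟩ := (AddCircle.equivIco 1 (-1 / 2 : ℝ)).symm.surjective s
    have hy1 := y.2.1
    have hy2 := y.2.2
    have hpi := Real.pi_pos
    refine ⟨2 * Real.pi * y, ⟨by nlinarith, by nlinarith⟩, ?_⟩
    rw [mul_div_cancel_left₀ _ (by positivity), ← hy]
    rfl
  obtain ⟨x, hx, hxt⟩ := h (t 0)
  obtain ⟨y, hy, hyt⟩ := h (t 1)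
  refine ⟨(x, y), ⟨hx, hy⟩, fun z => ?_⟩
  rw [← chr_coe]
  congr 1
  funext i
  fin_cases i
  · exact hxt.symm
  · exact hyt.symm

theorem norm_chr (z : Site) : ‖chr z‖ = 1 := mFourier_norm

/-- The Fourier coefficients of a continuous function on the torus. -/
noncomputable def coeff : C(Torus, ℂ) →L[ℂ] EllTwo Site :=
  pull siteEquiv siteEquiv.injective ∘L
    (mFourierBasis (d := Fin 2)).repr.toContinuousLinearEquiv.toContinuousLinearMap ∘L
    ContinuousMap.toLp (E := ℂ) 2 volume ℂ

theorem coeff_apply (f : C(Torus, ℂ)) (x : Site) :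
    coeff f x = mFourierCoeff f (siteEquiv x) := by
  change (mFourierBasis (d := Fin 2)).repr (ContinuousMap.toLp (E := ℂ) 2 volume ℂ f) _ = _
  rw [mFourierBasis_repr, mFourierCoeff_toLp]

theorem coeff_chr_mul (z : Site) (f : C(Torus, ℂ)) : coeff (chr z * f) = trans z (coeff f) := by
  ext x
  rw [pull_apply, coeff_apply, coeff_apply, mFourierCoeff, mFourierCoeff]
  congr 1
  funext t
  have : siteEquiv (x + z) = siteEquiv x + siteEquiv z := by
    ext i; fin_cases i <;> rfl
  rw [this, neg_add, mFourier_add, chr]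
  simp only [ContinuousMap.mul_apply, smul_eq_mul, mul_assoc]

theorem norm_coeff_sq (f : C(Torus, ℂ)) : ‖coeff f‖ ^ 2 = ∫ t, ‖f t‖ ^ 2 := by
  have h1 : ‖coeff f‖ = ‖ContinuousMap.toLp (E := ℂ) 2 (volume : Measure Torus) ℂ f‖ := by
    refine (norm_pull_equiv siteEquiv _).trans ?_
    exact (mFourierBasis (d := Fin 2)).repr.norm_map _
  rw [h1, ← inner_self_eq_norm_sq (𝕜 := ℂ) (ContinuousMap.toLp (E := ℂ) 2 volume ℂ f),
    ContinuousMap.inner_toLp]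
  have h2 : ∀ t, f t * (starRingEnd ℂ) (f t) = ((‖f t‖ ^ 2 : ℝ) : ℂ) := fun t => by
    rw [Complex.mul_conj, Complex.normSq_eq_norm_sq]
  simp only [h2]
  rw [integral_complex_ofReal]
  exact Complex.ofReal_re _

/-- Allows multiplier estimates to be checked on continuous functions, where they are pointwise
inequalities under an integral. -/
theorem denseRange_coeff : DenseRange coeff := by
  have h1 : DenseRange (ContinuousMap.toLp (E := ℂ) 2 (volume : Measure Torus) ℂ) :=
    ContinuousMap.toLp_denseRange ℂ volume ℂ (by simp)
  have h2 : Function.Surjective (pull siteEquiv siteEquiv.injective) := fun c =>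
    ⟨pull siteEquiv.symm siteEquiv.symm.injective c, by ext x; simp [pull_apply]⟩
  have h3 : Function.Surjective (pull siteEquiv siteEquiv.injective ∘L
    (mFourierBasis (d := Fin 2)).repr.toContinuousLinearEquiv.toContinuousLinearMap) :=
    h2.comp (mFourierBasis (d := Fin 2)).repr.surjective
  exact h3.denseRange.comp h1 (ContinuousLinearMap.continuous _)

variable (v : lp (fun _ : Site => ℝ) 1)

/-- The Fourier transform of `v` as a continuous function on the torus. -/
noncomputable def symbol : C(Torus, ℂ) := ∑' z, (v z : ℂ) • chr z

theorem hasSum_symbol : HasSum (fun z => (v z : ℂ) • chr z) (symbol v) := by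
  refine (Summable.of_norm_bounded (summable_norm_coeff v) fun z => ?_).hasSum
  rw [norm_smul, norm_chr, mul_one, Complex.norm_real]

theorem symbol_apply (t : Torus) (k : ℝ × ℝ)
    (h : ∀ z, chr z t = Complex.exp (-(Complex.I * dotk k z))) :
    symbol v t = fourier (fun x => v x) k := by
  have := (ContinuousMap.evalCLM ℂ t).hasSum (hasSum_symbol v)
  refine this.tsum_eq.symm.trans (tsum_congr fun z => ?_)
  change (v z : ℂ) * chr z t = _
  rw [h, mul_comm]

theorem formFactor_coeff (f : C(Torus, ℂ)) : formFactor v (coeff f) = coeff (symbol v * f) := by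
  have h1 := (coeff ∘L (ContinuousLinearMap.mul ℂ C(Torus, ℂ)).flip f).hasSum (hasSum_symbol v)
  have h2 := (ContinuousLinearMap.apply ℂ (EllTwo Site) (coeff f)).hasSum
    (hasSum_conv v fun z => Equiv.addRight z)
  refine h2.unique (h1.congr_fun fun z => ?_)
  change (v z : ℂ) • trans z (coeff f) = coeff (((v z : ℂ) • chr z) * f)
  rw [smul_mul_assoc, map_smul, coeff_chr_mul]

/-- A multiplier cannot exceed its operator norm on an open set: a test function supported where it
did would violate the norm bound. As a consequence, any point where `|v̂| = M` is a maximizer. -/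
theorem norm_symbol_le (t : Torus) : ‖symbol v t‖ ≤ ‖formFactor v‖ := by
  set M := ‖formFactor v‖
  -- The excess itself serves as test function: the norm bound applied to it reads `∫ F³ ≤ 0`, which
  -- forces `F = 0`.
  let F : Torus → ℝ := fun t => max 0 (‖symbol v t‖ ^ 2 - M ^ 2)
  have hF : Continuous F := by fun_prop
  let f : C(Torus, ℂ) := ⟨fun t => (F t : ℂ), by fun_prop⟩
  have h1 : ‖formFactor v (coeff f)‖ ^ 2 ≤ M ^ 2 * ‖coeff f‖ ^ 2 := by
    rw [← mul_pow]
    exact pow_le_pow_left₀ (norm_nonneg _) ((formFactor v).le_opNorm _) 2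
  rw [formFactor_coeff, norm_coeff_sq, norm_coeff_sq] at h1
  have int : ∀ g : Torus → ℝ, Continuous g → Integrable g := fun g hg =>
    hg.integrable_of_hasCompactSupport (HasCompactSupport.of_compactSpace g)
  have h2 : ∀ t, ‖(symbol v * f) t‖ ^ 2 - M ^ 2 * ‖f t‖ ^ 2 = F t ^ 3 := by
    intro t
    have hf : ‖f t‖ = F t := by
      change ‖(F t : ℂ)‖ = F t
      rw [Complex.norm_real, Real.norm_of_nonneg (le_max_left _ _)]
    rw [ContinuousMap.mul_apply, norm_mul, hf]
    rcases le_total 0 (‖symbol v t‖ ^ 2 - M ^ 2) with h | h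
    · have : F t = ‖symbol v t‖ ^ 2 - M ^ 2 := max_eq_right h
      rw [this]; ring
    · have : F t = 0 := max_eq_left h
      rw [this]; ring
  have h3 : ∫ t, F t ^ 3 ≤ 0 := by
    rw [← funext h2, integral_sub (int _ (by fun_prop)) (int _ (by fun_prop)), integral_const_mul]
    linarith
  have h4 : ∀ t, 0 ≤ F t ^ 3 := fun t => pow_nonneg (le_max_left _ _) 3
  have h5 : (fun t => F t ^ 3) = fun _ => 0 :=
    (Continuous.ae_eq_iff_eq volume (by fun_prop) continuous_const).1
      ((integral_eq_zero_iff_of_nonneg h4 (int _ (by fun_prop))).1 (h3.antisymm (integral_nonneg h4)))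
  have h6 : F t = 0 := pow_eq_zero_iff (by norm_num) |>.1 (congrFun h5 t)
  have h7 : ‖symbol v t‖ ^ 2 - M ^ 2 ≤ 0 := h6 ▸ le_max_right _ _
  exact abs_le_of_sq_le_sq' (by linarith) (norm_nonneg _) |>.2

theorem norm_fourier_le (k : ℝ × ℝ) : ‖fourier (fun x => v x) k‖ ≤ ‖formFactor v‖ := by
  rw [← symbol_apply v _ k fun z => chr_coe z k]
  exact norm_symbol_le v _

/-- A continuous function vanishing where `|v̂|` is maximal is controlled by the distance of `|v̂|`
to its maximum. -/
theorem exists_symbol_bound (hM : 0 < ‖formFactor v‖) (r : C(Torus, ℂ))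
    (hr : ∀ t, ‖symbol v t‖ = ‖formFactor v‖ → r t = 0) {η : ℝ} (hη : 0 < η) :
    ∃ C : ℝ, 0 ≤ C ∧ ∀ t, ‖r t‖ ^ 2 ≤
      η + C * (1 - ‖symbol v t‖ ^ 2 / ‖formFactor v‖ ^ 2) := by
  set M := ‖formFactor v‖
  have hg : ∀ t, 0 ≤ 1 - ‖symbol v t‖ ^ 2 / M ^ 2 := fun t => by
    rw [sub_nonneg, div_le_one (by positivity)]
    exact pow_le_pow_left₀ (norm_nonneg _) (norm_symbol_le v t) 2
  -- On this compact set `|v̂|` stays strictly below `M`, so the gap has a positive minimum;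
  -- dividing `‖r‖²` by it gives `C`. Off the set, `η` suffices.
  have hK : IsCompact {t : Torus | η ≤ ‖r t‖ ^ 2} :=
    (isClosed_le continuous_const (by fun_prop)).isCompact
  rcases Set.eq_empty_or_nonempty {t : Torus | η ≤ ‖r t‖ ^ 2} with he | hne
  · refine ⟨0, le_rfl, fun t => ?_⟩
    have : t ∉ {t : Torus | η ≤ ‖r t‖ ^ 2} := he ▸ Set.notMem_empty t
    rw [zero_mul, add_zero]
    exact (not_le.1 this).le
  · obtain ⟨s, hs, hmin⟩ := hK.exists_isMinOn hne
      (f := fun t => 1 - ‖symbol v t‖ ^ 2 / M ^ 2) (by fun_prop)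
    have hpos : 0 < 1 - ‖symbol v s‖ ^ 2 / M ^ 2 := by
      refine (hg s).lt_of_ne fun h0 => ?_
      have h1 : ‖symbol v s‖ ^ 2 = M ^ 2 := by
        have : ‖symbol v s‖ ^ 2 / M ^ 2 = 1 := by linarith
        rwa [div_eq_one_iff_eq (by positivity)] at this
      have h2 := hr s ((pow_left_inj₀ (norm_nonneg _) hM.le (by norm_num)).1 h1)
      have h3 : η ≤ ‖r s‖ ^ 2 := hs
      rw [h2] at h3
      simp at h3
      linarith
    refine ⟨‖r‖ ^ 2 / (1 - ‖symbol v s‖ ^ 2 / M ^ 2), by positivity, fun t => ?_⟩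
    by_cases ht : η ≤ ‖r t‖ ^ 2
    · have h1 : 1 - ‖symbol v s‖ ^ 2 / M ^ 2 ≤ 1 - ‖symbol v t‖ ^ 2 / M ^ 2 := hmin ht
      calc ‖r t‖ ^ 2 ≤ ‖r‖ ^ 2 := pow_le_pow_left₀ (norm_nonneg _) (r.norm_coe_le_norm t) 2
        _ = ‖r‖ ^ 2 / (1 - ‖symbol v s‖ ^ 2 / M ^ 2) * (1 - ‖symbol v s‖ ^ 2 / M ^ 2) := by
          rw [div_mul_cancel₀ _ hpos.ne']
        _ ≤ ‖r‖ ^ 2 / (1 - ‖symbol v s‖ ^ 2 / M ^ 2) * (1 - ‖symbol v t‖ ^ 2 / M ^ 2) := by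
          gcongr
        _ ≤ _ := le_add_of_nonneg_left hη.le
    · have := hg t
      exact (not_le.1 ht).le.trans (le_add_of_nonneg_right (by positivity))

/-- A Fourier multiplier vanishing where `|v̂|` is maximal is small on almost maximizers of
`‖V b‖`. -/
theorem exists_multiplier_bound (hM : 0 < ‖formFactor v‖) (R : EllTwo Site →L[ℂ] EllTwo Site)
    (r : C(Torus, ℂ)) (hR : ∀ f, R (coeff f) = coeff (r * f))
    (hr : ∀ t, ‖symbol v t‖ = ‖formFactor v‖ → r t = 0) {η : ℝ} (hη : 0 < η) :
    ∃ C : ℝ, 0 ≤ C ∧ ∀ b, ‖R b‖ ^ 2 ≤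
      η * ‖b‖ ^ 2 + C * (‖b‖ ^ 2 - ‖formFactor v b‖ ^ 2 / ‖formFactor v‖ ^ 2) := by
  obtain ⟨C, hC, h⟩ := exists_symbol_bound v hM r hr hη
  refine ⟨C, hC, fun b => ?_⟩
  refine denseRange_coeff.induction_on b (isClosed_le (by fun_prop) (by fun_prop)) fun f => ?_
  have int : ∀ g : Torus → ℝ, Continuous g → Integrable g := fun g hg =>
    hg.integrable_of_hasCompactSupport (HasCompactSupport.of_compactSpace g)
  rw [hR, formFactor_coeff, norm_coeff_sq, norm_coeff_sq, norm_coeff_sq, ← integral_const_mul,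
    ← integral_div, ← integral_sub (int _ (by fun_prop)) (int _ (by fun_prop)),
    ← integral_const_mul, ← integral_add (int _ (by fun_prop)) (int _ (by fun_prop))]
  refine integral_mono (int _ (by fun_prop)) (int _ (by fun_prop)) fun t => ?_
  have := mul_le_mul_of_nonneg_right (h t) (sq_nonneg ‖f t‖)
  simp only [ContinuousMap.mul_apply, norm_mul, mul_pow]
  calc _ ≤ _ := this
    _ = _ := by ring

end Torus
-- The `d`-wave orbital and the defect multipliers.
section Orbitals

theorem sOrbital_apply (k : ℝ × ℝ) (y : Site) : sOrbital k y =
    if y ∈ nn then (1 / 2) * Complex.exp (Complex.I * dotk k y) else 0 := by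
  simp only [sOrbital, mul_ite, mul_one, mul_zero, Finset.sum_ite_eq]

theorem exp_dotk_left (y : Site) :
    Complex.exp (Complex.I * dotk (-Real.pi, 0) y) = (-1) ^ y.1 := by
  have h : Complex.I * dotk (-Real.pi, 0) y = ((-y.1 : ℤ) : ℂ) * (Real.pi * Complex.I) := by
    simp only [dotk]; push_cast; ring
  rw [h, Complex.exp_int_mul, Complex.exp_pi_mul_I, zpow_neg, ← inv_zpow, inv_neg, inv_one]

theorem exp_dotk_right (y : Site) :
    Complex.exp (Complex.I * dotk (0, -Real.pi) y) = (-1) ^ y.2 := by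
  have h : Complex.I * dotk (0, -Real.pi) y = ((-y.2 : ℤ) : ℂ) * (Real.pi * Complex.I) := by
    simp only [dotk]; push_cast; ring
  rw [h, Complex.exp_int_mul, Complex.exp_pi_mul_I, zpow_neg, ← inv_zpow, inv_neg, inv_one]

theorem dotk_neg (k : ℝ × ℝ) (y : Site) : dotk k (-y) = -dotk k y := by
  simp only [dotk, Prod.fst_neg, Prod.snd_neg]; push_cast; ring

theorem dOrbital_apply (y : Site) :
    dOrbital y = if y ∈ nn then (1 / 2) * (-1) ^ y.1 else 0 := by
  rw [dOrbital, sOrbital_apply, exp_dotk_left]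

theorem dOrbital_eq_neg : dOrbital = -sOrbital (0, -Real.pi) := by
  funext y
  rw [Pi.neg_apply, dOrbital_apply, sOrbital_apply, exp_dotk_right]
  split_ifs with hy
  · simp only [nn, Finset.mem_insert, Finset.mem_singleton] at hy
    rcases hy with rfl | rfl | rfl | rfl <;> norm_num
  · simp

theorem fourier_dOrbital (k : ℝ × ℝ) : fourier dOrbital k = Real.cos k.2 - Real.cos k.1 := by
  rw [fourier, tsum_eq_sum (s := nn) fun y hy => by rw [dOrbital_apply, if_neg hy, mul_zero],
    Finset.sum_congr rfl fun y hy => by rw [dOrbital_apply, if_pos hy], sum_nn]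
  simp only [dotk, Complex.ofReal_cos, Complex.cos]
  norm_num
  ring_nf

/-- The defect `1 - 𝐝(u) ∑_{u'} 𝐝(u') T_{u-u'}`, which measures by how much the nearest-neighbour
pairs generated by a boson deviate from `d`-wave pairs. -/
noncomputable def defect (u : Site) : EllTwo Site →L[ℂ] EllTwo Site :=
  ContinuousLinearMap.id ℂ _ - dOrbital u • ∑ u' ∈ nn, dOrbital u' • trans (u - u')

/-- The symbol of `defect u`. -/
noncomputable def defectSymbol (u : Site) : C(Torus, ℂ) :=
  1 - dOrbital u • ∑ u' ∈ nn, dOrbital u' • chr (u - u')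

theorem defect_coeff (u : Site) (f : C(Torus, ℂ)) :
    defect u (coeff f) = coeff (defectSymbol u * f) := by
  simp only [defect, defectSymbol, sub_mul, one_mul, smul_mul_assoc, Finset.sum_mul, map_sub,
    map_smul, map_sum, coeff_chr_mul, sub_apply, smul_apply, sum_apply,
    ContinuousLinearMap.id_apply]

theorem chr_of_exp {t : Torus} {k : ℝ × ℝ}
    (h : ∀ z, chr z t = Complex.exp (-(Complex.I * dotk k z))) (z : Site) :
    chr z t = Complex.exp (Complex.I * dotk k (-z)) := by
  rw [h, dotk_neg]; push_cast; rw [mul_neg]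

/-- At both momenta `e^{ik·(u'-u)} = 4𝐝(u)𝐝(u')` for nearest neighbours, as the common sign squares
away. The subtracted term is then `4𝐝(u)² ∑ 𝐝(u')² = 1`. -/
theorem defectSymbol_eq_zero {u : Site} (hu : u ∈ nn) {t : Torus} {k : ℝ × ℝ}
    (h : ∀ z, chr z t = Complex.exp (-(Complex.I * dotk k z)))
    (hk : k ∈ ({(-Real.pi, 0), (0, -Real.pi)} : Set (ℝ × ℝ))) : defectSymbol u t = 0 := by
  have h1 : defectSymbol u t =
      1 - dOrbital u * ∑ u' ∈ nn, dOrbital u' * Complex.exp (Complex.I * dotk k (u' - u)) := by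
    simp only [defectSymbol, ContinuousMap.sub_apply, ContinuousMap.one_apply,
      ContinuousMap.smul_apply, ContinuousMap.sum_apply, smul_eq_mul, chr_of_exp h, neg_sub]
  rw [h1, Finset.sum_congr rfl fun y hy => by rw [dOrbital_apply, if_pos hy], sum_nn,
    dOrbital_apply, if_pos hu]
  simp only [nn, Finset.mem_insert, Finset.mem_singleton] at hu
  rcases hk with rfl | rfl
  · simp only [exp_dotk_left]
    rcases hu with rfl | rfl | rfl | rfl <;> norm_num
  · simp only [exp_dotk_right]
    rcases hu with rfl | rfl | rfl | rfl <;> norm_num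

theorem trans_trans (u u' : Site) (g : EllTwo Site) :
    trans u (trans (-u') g) = trans (u - u') g := by
  ext x
  change g (x + u + -u') = g (x + (u - u'))
  rw [add_assoc, sub_eq_add_neg]

/-- Both operators are built from translations; thus smallness of the defect on `b` passes to `V b`
at the cost of a factor `‖V‖`. -/
theorem formFactor_defect (v : lp (fun _ : Site => ℝ) 1) (u : Site) (b : EllTwo Site) :
    formFactor v (defect u b) = defect u (formFactor v b) := by
  simp only [defect, map_sub, map_smul, map_sum, sub_apply, smul_apply, sum_apply,
    ContinuousLinearMap.id_apply, conv_trans]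

/-- The `d`-wave component `x ↦ ∑_u 𝐝(u) 𝔠(x, x - u)` of a pair wave function. -/
noncomputable def dComponent : EllTwo (Site × Site) →L[ℂ] EllTwo Site :=
  ∑ u ∈ nn, dOrbital u • (trans (-u) ∘L pull (diag u) (diag_injective u))

/-- The `d`-wave pair wave function `(x, y) ↦ 𝐝(x - y) f(x)`. -/
noncomputable def dWave : EllTwo Site →L[ℂ] EllTwo (Site × Site) :=
  ∑ u ∈ nn, dOrbital u • (push (diag u) (diag_injective u) ∘L trans u)

theorem dWave_apply (f : EllTwo Site) (p : Site × Site) :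
    dWave f p = dOrbital (p.1 - p.2) * f p.1 := by
  have h1 : dWave f p =
      ∑ u ∈ nn, dOrbital u * if p.1 = p.2 + u then f (p.2 + u) else 0 := by
    simp only [dWave, sum_apply, smul_apply, ContinuousLinearMap.comp_apply, lp.coeFn_sum,
      Finset.sum_apply, lp.coeFn_smul, Pi.smul_apply, smul_eq_mul, push_diag, pull_apply]
  have h2 : ∀ u : Site, (dOrbital u * if p.1 = p.2 + u then f (p.2 + u) else 0) =
      if p.1 - p.2 = u then dOrbital u * f p.1 else 0 := by
    intro u
    by_cases hu : p.1 = p.2 + u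
    · rw [if_pos hu, if_pos (sub_eq_iff_eq_add'.2 hu), hu]
    · rw [if_neg hu, if_neg fun h => hu (sub_eq_iff_eq_add'.1 h), mul_zero]
  rw [h1, Finset.sum_congr rfl fun u _ => h2 u, Finset.sum_ite_eq]
  split_ifs with hp
  · rfl
  · rw [dOrbital_apply, if_neg hp, zero_mul]

/-- Diagonals are parametrized by the spin-down site but `f` by the spin-up site. Passing from
diagonal `u'` to diagonal `u` through `f` therefore costs a translation by `u - u'`, which produces
exactly `defect u`. -/
theorem sub_dWave_dComponent_pairWave (g : EllTwo Site) :
    pairWave g - dWave (dComponent (pairWave g)) =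
      ∑ u ∈ nn, push (diag u) (diag_injective u) (defect u g) := by
  have h1 : dComponent (pairWave g) = ∑ u ∈ nn, dOrbital u • trans (-u) g := by
    simp only [dComponent, sum_apply, smul_apply, ContinuousLinearMap.comp_apply]
    refine Finset.sum_congr rfl fun u hu => ?_
    rw [pull_diag_pairWave, if_pos hu]
  rw [h1]
  simp only [dWave, pairWave, sum_apply, smul_apply, ContinuousLinearMap.comp_apply]
  rw [← Finset.sum_sub_distrib]
  refine Finset.sum_congr rfl fun u _ => ?_
  simp only [defect, sub_apply, smul_apply, sum_apply, ContinuousLinearMap.id_apply, map_sub,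
    map_smul, map_sum, trans_trans]

theorem norm_sub_dWave_pairWave_le (v : lp (fun _ : Site => ℝ) 1) (b : EllTwo Site) {s : ℝ}
    (hs : ∀ u ∈ nn, ‖defect u b‖ ≤ s) :
    ‖pairWave (formFactor v b) - dWave (dComponent (pairWave (formFactor v b)))‖ ≤
      4 * ‖formFactor v‖ * s := by
  rw [sub_dWave_dComponent_pairWave]
  refine (norm_sum_le_of_le nn fun u hu => ?_).trans_eq
    ((Finset.sum_const (‖formFactor v‖ * s)).trans ?_)
  · rw [← formFactor_defect]
    exact (norm_push_apply_le _ _ _).trans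
      (((formFactor v).le_opNorm _).trans (mul_le_mul_of_nonneg_left (hs u hu) (norm_nonneg _)))
  · rw [show nn.card = 4 from rfl, nsmul_eq_mul]; push_cast; ring

end Orbitals

/-! ### From low energy to `d`-wave pairing. -/

section Main

variable (v : lp (fun _ : Site => ℝ) 1)

/-- If `V` vanished, so would `v̂`, and every momentum, in particular `0`, would be a maximizer. -/
theorem formFactor_pos
    (hK : maximizers (fun x => v x) = {(-Real.pi, 0), (0, -Real.pi)}) : 0 < ‖formFactor v‖ := by
  refine (norm_nonneg _).lt_of_ne fun h0 => ?_
  have hz : ∀ k, ‖fourier (fun x => v x) k‖ = 0 := fun k =>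
    le_antisymm (h0 ▸ norm_fourier_le v k) (norm_nonneg _)
  have h1 : ((0, 0) : ℝ × ℝ) ∈ maximizers (fun x => v x) := by
    have hpi := Real.pi_pos
    exact ⟨⟨⟨by simpa using hpi.le, hpi⟩, ⟨by simpa using hpi.le, hpi⟩⟩,
      fun q _ => by rw [hz, hz]⟩
  rw [hK] at h1
  rcases h1 with h1 | h1
  · simpa using (Prod.ext_iff.1 h1).1
  · simpa using (Prod.ext_iff.1 h1).2

theorem exists_defect_bound
    (hK : maximizers (fun x => v x) = {(-Real.pi, 0), (0, -Real.pi)}) {η : ℝ} (hη : 0 < η) :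
    ∃ C : ℝ, 0 ≤ C ∧ ∀ u ∈ nn, ∀ b : EllTwo Site, ‖defect u b‖ ^ 2 ≤
      η * ‖b‖ ^ 2 + C * (‖b‖ ^ 2 - ‖formFactor v b‖ ^ 2 / ‖formFactor v‖ ^ 2) := by
  have hM := formFactor_pos v hK
  have h1 : ∀ u ∈ nn, ∃ C : ℝ, 0 ≤ C ∧ ∀ b : EllTwo Site, ‖defect u b‖ ^ 2 ≤
      η * ‖b‖ ^ 2 + C * (‖b‖ ^ 2 - ‖formFactor v b‖ ^ 2 / ‖formFactor v‖ ^ 2) := fun u hu => by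
    refine exists_multiplier_bound v hM (defect u) (defectSymbol u) (defect_coeff u)
      (fun t ht => ?_) hη
    obtain ⟨k, hk, hkt⟩ := exists_brillouin t
    refine defectSymbol_eq_zero hu hkt (hK ▸ ⟨hk, fun q _ => ?_⟩)
    rw [← symbol_apply v t k hkt, ht]
    exact norm_fourier_le v q
  choose! C hC h using h1
  -- The sum of the four constants dominates each of them and so serves all directions at once.
  refine ⟨∑ u ∈ nn, C u, Finset.sum_nonneg hC, fun u hu b => (h u hu b).trans ?_⟩
  have h2 : 0 ≤ ‖b‖ ^ 2 - ‖formFactor v b‖ ^ 2 / ‖formFactor v‖ ^ 2 := by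
    rw [sub_nonneg, div_le_iff₀ (by positivity), mul_comm, ← mul_pow]
    exact pow_le_pow_left₀ (norm_nonneg _) ((formFactor v).le_opNorm b) 2
  gcongr
  exact Finset.single_le_sum hC hu

/-- States close to pair waves generated by bosons whose momenta maximize `|v̂|` are close to
`d`-wave states. -/
theorem exists_dWave_bound
    (hK : maximizers (fun x => v x) = {(-Real.pi, 0), (0, -Real.pi)}) {η : ℝ} (hη : 0 < η) :
    ∃ δ > (0 : ℝ), ∀ (c : EllTwo (Site × Site)) (b : EllTwo Site), ‖b‖ ≤ 1 →
      ‖c + ((1 / (2 * ‖formFactor v‖) : ℝ) : ℂ) • pairWave (formFactor v b)‖ ^ 2 +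
        (‖b‖ ^ 2 - ‖formFactor v b‖ ^ 2 / ‖formFactor v‖ ^ 2) ≤ δ →
      ‖c - dWave (dComponent c)‖ ^ 2 ≤ η := by
  have hM := formFactor_pos v hK
  obtain ⟨C, hC, hCb⟩ := exists_defect_bound v hK (η := η / 32) (by positivity)
  set D : EllTwo (Site × Site) →L[ℂ] EllTwo (Site × Site) :=
    ContinuousLinearMap.id ℂ _ - dWave ∘L dComponent with hD
  have hDa : ∀ c, D c = c - dWave (dComponent c) := fun c => rfl
  -- This makes `Cδ` and `‖D‖²δ` at most `η/32`. The error from the distance to the pair wave is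
  -- then at most `η/32`, the one from the pair wave itself at most `η/4`, and doubling their sum
  -- stays below `η`.
  refine ⟨η / (32 * (C + ‖D‖ ^ 2 + 1)), by positivity, fun c b hb hcb => ?_⟩
  set M := ‖formFactor v‖
  set δ := η / (32 * (C + ‖D‖ ^ 2 + 1)) with hδ
  have hδ0 : 0 < δ := by positivity
  have hδe : 32 * (C + ‖D‖ ^ 2 + 1) * δ = η := by rw [hδ]; field_simp
  have hCδ : C * δ ≤ η / 32 := by nlinarith [sq_nonneg ‖D‖]
  have hDδ : ‖D‖ ^ 2 * δ ≤ η / 32 := by nlinarith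
  have h2 : 0 ≤ ‖b‖ ^ 2 - ‖formFactor v b‖ ^ 2 / M ^ 2 := by
    rw [sub_nonneg, div_le_iff₀ (by positivity), mul_comm, ← mul_pow]
    exact pow_le_pow_left₀ (norm_nonneg _) ((formFactor v).le_opNorm b) 2
  set g := formFactor v b
  set r : ℂ := ((1 / (2 * M) : ℝ) : ℂ) with hr
  have hrn : ‖r‖ = 1 / (2 * M) := by
    rw [hr, Complex.norm_real, Real.norm_of_nonneg (by positivity)]
  have hs : ∀ u ∈ nn, ‖defect u b‖ ≤ Real.sqrt (η / 16) := fun u hu => by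
    refine Real.le_sqrt_of_sq_le ((hCb u hu b).trans ?_)
    have hb2 : ‖b‖ ^ 2 ≤ 1 := pow_le_one₀ (norm_nonneg _) hb
    have h3 : C * (‖b‖ ^ 2 - ‖g‖ ^ 2 / M ^ 2) ≤ C * δ :=
      mul_le_mul_of_nonneg_left (by linarith [sq_nonneg ‖c + r • pairWave g‖]) hC
    nlinarith
  -- By linearity, the non-`d`-wave part of `c` splits into that of a small vector, controlled by
  -- `‖D‖`, and that of a pair wave, controlled by the defects.
  have h4 : D c = D (c + r • pairWave g) - r • D (pairWave g) := by
    rw [map_add, map_smul, add_sub_cancel_right]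
  have h5 : ‖D (c + r • pairWave g)‖ ^ 2 ≤ η / 32 := by
    refine le_trans ?_ hDδ
    calc _ ≤ (‖D‖ * ‖c + r • pairWave g‖) ^ 2 :=
          pow_le_pow_left₀ (norm_nonneg _) (D.le_opNorm _) 2
      _ ≤ _ := by
        rw [mul_pow]
        gcongr
        linarith
  have h6 : ‖r • D (pairWave g)‖ ≤ 2 * Real.sqrt (η / 16) := by
    rw [norm_smul, hrn]
    calc _ ≤ 1 / (2 * M) * (4 * M * Real.sqrt (η / 16)) := by
          gcongr
          exact norm_sub_dWave_pairWave_le v b hs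
      _ = _ := by field_simp; ring
  have h7 : ‖r • D (pairWave g)‖ ^ 2 ≤ η / 4 := by
    calc _ ≤ (2 * Real.sqrt (η / 16)) ^ 2 := pow_le_pow_left₀ (norm_nonneg _) h6 2
      _ = η / 4 := by rw [mul_pow, Real.sq_sqrt (by positivity)]; ring
  have h8 := norm_sub_le (D (c + r • pairWave g)) (r • D (pairWave g))
  rw [← hDa, h4]
  calc _ ≤ (‖D (c + r • pairWave g)‖ + ‖r • D (pairWave g)‖) ^ 2 :=
        pow_le_pow_left₀ (norm_nonneg _) h8 2
    _ ≤ 2 * (‖D (c + r • pairWave g)‖ ^ 2 + ‖r • D (pairWave g)‖ ^ 2) := add_sq_le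
    _ ≤ η := by linarith

/-- The lower and upper energy bounds differ by `(8 + 4h_b)h + M²/U`, and the spectral window
contributes at most `wε` more. Dividing by `w` bounds the two defects. -/
theorem exists_low_energy_bound {κ hb : ℝ} (hhb : 0 ≤ hb) (hM : 0 < ‖formFactor v‖)
    {δ : ℝ} (hδ : 0 < δ) :
    ∃ ε₀ > (0 : ℝ), ∃ h₀ > (0 : ℝ), ∃ U₀ > (0 : ℝ),
      ∀ ε ∈ Set.Ioo 0 ε₀, ∀ h ∈ Set.Ioo 0 h₀, ∀ U > U₀, ∀ ψ : Sector, ‖ψ‖ = 1 →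
      ψ ∈ spectralRange (sectorHamiltonian h U hb κ v)
        (Set.Icc (groundEnergy h U hb κ v) (groundEnergy h U hb κ v * (1 - ε))) →
      ‖ψ.fst + ((1 / (2 * ‖formFactor v‖) : ℝ) : ℂ) • pairWave (formFactor v ψ.snd)‖ ^ 2 +
        (‖ψ.snd‖ ^ 2 - ‖formFactor v ψ.snd‖ ^ 2 / ‖formFactor v‖ ^ 2) ≤ δ := by
  have ha : 0 < Real.exp (-κ) := Real.exp_pos _
  have hden : 0 < 8 + 4 * hb := by positivity
  set M := ‖formFactor v‖ with hMdef
  set w := 2 * Real.exp (-κ) * M with hw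
  have hw0 : 0 < w := by positivity
  -- Each of the errors from `ε`, `h` and `U` is allotted `wδ/3`. The bound `ε < 1` keeps `1 - ε`
  -- positive, so the upper bound on `E₀` can be multiplied by it whatever the sign of `E₀`.
  refine ⟨min 1 (δ / 3), by positivity, w * δ / (3 * (8 + 4 * hb)), by positivity,
    3 * M ^ 2 / (w * δ), by positivity, fun ε hε h hh U hU ψ hψ hs => ?_⟩
  have hU0 : 0 < U := lt_trans (by positivity) hU
  have h1 := energy_lower_bound (κ := κ) v hh.1.le hhb hU0 hM hψ
  have h2 := re_inner_le_of_mem_spectralRange (isSelfAdjoint_sectorHamiltonian h U hb κ v) hs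
  have h3 := groundEnergy_le (U := U) (κ := κ) v hh.1.le hhb hM
  rw [hψ, one_pow, mul_one] at h2
  rw [← hMdef, ← hw] at h1 h3
  have hε1 : ε < 1 := hε.2.trans_le (min_le_left _ _)
  have hε3 : ε < δ / 3 := hε.2.trans_le (min_le_right _ _)
  have hh3 : (8 + 4 * hb) * h ≤ w * δ / 3 := by
    have := (lt_div_iff₀ (by positivity)).1 hh.2
    linarith
  have hU3 : M ^ 2 / U ≤ w * δ / 3 := by
    have := (div_lt_iff₀ (by positivity)).1 hU
    rw [div_le_iff₀ hU0]
    linarith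
  have h4 : groundEnergy h U hb κ v * (1 - ε) ≤ ((8 + 4 * hb) * h - w) * (1 - ε) :=
    mul_le_mul_of_nonneg_right h3 (by linarith)
  have h5 : 0 ≤ (8 + 4 * hb) * h * ε := mul_nonneg (mul_nonneg hden.le hh.1.le) hε.1.le
  have h6 : w * ε ≤ w * (δ / 3) := mul_le_mul_of_nonneg_left hε3.le hw0.le
  refine le_of_mul_le_mul_left ?_ hw0
  linarith

end Main
end DWave

/-! ### The corollary for low-energy evolutions. -/

theorem corollary3p4 (v : lp (fun _ : ℤ × ℤ => ℝ) 1)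
    (hsymm : ∀ x : ℤ × ℤ, v (-x) = v x) (hrot : ∀ x₁ x₂ : ℤ, v (-x₂, x₁) = v (x₁, x₂))
    (κ hb : ℝ) (hκ : 0 < κ) (hhb : 0 ≤ hb)
    (hK : DWave.maximizers (fun x => v x) = {(-Real.pi, 0), (0, -Real.pi)}) :
    (∀ η : ℝ, 0 < η → ∃ ε₀ > (0 : ℝ), ∃ h₀ > (0 : ℝ), ∃ U₀ > (0 : ℝ),
      ∀ ε ∈ Set.Ioo 0 ε₀, ∀ h ∈ Set.Ioo 0 h₀, ∀ U > U₀,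
      ∀ ψ ∈ DWave.lowEnergyEvolutions ε h U hb κ v,
      ∃ f : C(ℝ, lp (fun _ : ℤ × ℤ => ℂ) 2), ∀ t : ℝ,
        Summable (fun p : (ℤ × ℤ) × (ℤ × ℤ) =>
          ‖(ψ t).fst p - DWave.dOrbital (p.1 - p.2) * f t p.1‖ ^ 2) ∧
        ∑' p : (ℤ × ℤ) × (ℤ × ℤ), ‖(ψ t).fst p - DWave.dOrbital (p.1 - p.2) * f t p.1‖ ^ 2 ≤ η) ∧
    DWave.dOrbital = -DWave.sOrbital (0, -Real.pi) ∧
    ∀ k : ℝ × ℝ, DWave.fourier DWave.dOrbital k = Real.cos k.2 - Real.cos k.1 := by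
  refine ⟨fun η hη => ?_, DWave.dOrbital_eq_neg, DWave.fourier_dOrbital⟩
  obtain ⟨δ, hδ, hclose⟩ := DWave.exists_dWave_bound v hK hη
  obtain ⟨ε₀, hε₀, h₀, hh₀, U₀, hU₀, henergy⟩ :=
    DWave.exists_low_energy_bound (κ := κ) v hhb (DWave.formFactor_pos v hK) hδ
  refine ⟨ε₀, hε₀, h₀, hh₀, U₀, hU₀, fun ε hε h hh U hU ψ hψ => ?_⟩
  -- The amplitude `f` depends on `𝔠` through a bounded linear map, so it inherits continuity in
  -- time from the solution.
  have hcont : Continuous fun t => DWave.dComponent (ψ t).fst :=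
    DWave.dComponent.continuous.comp
      ((WithLp.prodContinuousLinearEquiv 2 ℂ _ _).continuous.comp hψ.1.continuous).fst
  refine ⟨⟨fun t => DWave.dComponent (ψ t).fst, hcont⟩, fun t => ?_⟩
  obtain ⟨-, hnorm, hrange⟩ := hψ.2 t
  have hb1 : ‖(ψ t).snd‖ ≤ 1 := by
    have := DWave.sector_norm_sq (ψ t)
    rw [hnorm] at this
    nlinarith [norm_nonneg (ψ t).snd, sq_nonneg ‖(ψ t).fst‖]
  have hle := hclose _ _ hb1 (henergy ε hε h hh U hU (ψ t) hnorm hrange)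
  have hsum : HasSum (fun p : (ℤ × ℤ) × (ℤ × ℤ) =>
      ‖(ψ t).fst p - DWave.dOrbital (p.1 - p.2) * DWave.dComponent (ψ t).fst p.1‖ ^ 2)
      (‖(ψ t).fst - DWave.dWave (DWave.dComponent (ψ t).fst)‖ ^ 2) := by
    have := lp.hasSum_norm (p := 2) (by norm_num)
      ((ψ t).fst - DWave.dWave (DWave.dComponent (ψ t).fst))
    simpa [DWave.dWave_apply] using this
  exact ⟨hsum.summable, hsum.tsum_eq.trans_le hle⟩
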